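/- **Uniform Weinberg theorem.** Consider the rank-six $U(1)$ tensor field theory with quartic melonic interactions, mass $m>0$ and gauge-invariant propagator $$C(\vec p)=\frac{\delta_{\sum_{c}p_c,\,0}}{|\vec p|^2+m^2},\qquad \vec p=(p_1,\dots,p_6)\in\mathbb Z^6 .$$ A vertex of a Feynman graph $\mathcal G$ is a bubble with a special color $c\in\{1,\dots,6\}$; for $c=1$ it is $\sum\bar\phi(p_1,p_2,\dots,p_6)\,\phi(p_1',p_2,\dots,p_6)\,\bar\phi(p_1',p_2',\dots,p_6')\,\phi(p_1,p_2',\dots,p_6')$. An internal line joins a field $\phi$ to a field $\bar\phi$, and the fields not joined to another are the external half-lines. Faces of color $c$ are the connected components formed by the strands of color $c$ of lines and vertices; they are internal if closed, and external if they end on external half-lines. The amplitude of $\mathcal G$ at fixed integer momenta of the external faces is $$\mathcal A(\mathcal G)=\sum_{(p_f)\in\mathbb Z^{\{\text{internal faces } f\}}}\ \prod_{\ell\ \text{internal line}} C(\vec p^{\,\ell}),$$ where $p^{\ell}_c$ is the momentum of the face of color $c$ through $\ell$. A subgraph $\mathcal H\subset\mathcal G$ is a nonempty set of internal lines with the vertices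 attached to them; its divergence degree is $\omega(\mathcal H)=-2L(\mathcal H)+F(\mathcal H)-R(\mathcal H)$, where $L(\mathcal H)$ is its number of lines, $F(\mathcal H)$ its number of internal faces (closed faces running only through lines of $\mathcal H$), and $R(\mathcal H)$ the rank of the incidence matrix between its lines and its internal faces. Then, for every $m>0$, there is a constant $K>0$, depending only on $m$, such that for every connected graph $\mathcal G$ with $n(\mathcal G)$ vertices that is completely convergent, i.e. $\omega(\mathcal H)<0$ for all connected subgraphs $\mathcal H\subset\mathcal G$ ($\mathcal G$ itself included), and for all external momenta, the sum defining $\mathcal A(\mathcal G)$ converges absolutely and $$|\mathcal A(\mathcal G)|\le K^{n(\mathcal G)} .$$ -/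

import Mathlib

/-- A Feynman graph of the rank-six quartic melonic tensor model, with set of vertices `V` (quartic
bubbles) and set of internal lines `L`. A vertex `v` carries a special color and four half-lines:
the two fields `φ` numbered `(v, false)`, `(v, true)` and the two conjugate fields `φ̄` numbered
in the same way. A line (Wick contraction) joins a field `φ` to a field `φ̄`, and each field belongs
to at most one line; the fields that belong to no line are the external half-lines. -/
structure FeynmanGraph (V : Type*) (L : Type*) where
  /-- the special color of a vertex -/
  color : V → Fin 6
  /-- the field `φ` at one end of a line -/
  src : L → V × Bool
  /-- the field `φ̄` at the other end of a line -/
  tgt : L → V × Bool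
  src_injective : Function.Injective src
  tgt_injective : Function.Injective tgt

namespace FeynmanGraph

variable {V L : Type*} (G : FeynmanGraph V L)

/-- The strand of color `c` inside a bubble starting at the field `φ̄` number `h` ends at the field
`φ` number `G.strand c h`. For
`∑ φ̄(p₁, p₂, …, p₆) φ(p₁', p₂, …, p₆) φ̄(p₁', p₂', …, p₆') φ(p₁, p₂', …, p₆')` (special color `1`)
the conjugate field and the field with the same number are joined by the five non-special colors,
and the special color joins fields of different numbers. -/
def strand (c : Fin 6) (h : V × Bool) : V × Bool :=
  (h.1, if c = G.color h.1 then !h.2 else h.2)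

/-- Strand `c` of the line `ℓ` is followed, across a bubble, by strand `c` of the line `ℓ'`. -/
def FaceStep (x y : L × Fin 6) : Prop :=
  x.2 = y.2 ∧ G.strand x.2 (G.tgt x.1) = G.src y.1

/-- Faces of color `c` are the connected components made of strands of color `c`, of lines and of
bubbles. A face is given here as the class of the strands `(ℓ, c)` of lines it runs through. -/
def Face : Type _ := Quot G.FaceStep

/-- The face through strand `c` of the line `ℓ`. -/
def face (ℓ : L) (c : Fin 6) : G.Face := Quot.mk _ (ℓ, c)

instance [Finite L] : Finite G.Face := inferInstanceAs (Finite (Quot G.FaceStep))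

noncomputable instance [Finite L] : Fintype G.Face := Fintype.ofFinite _

/-- A face is internal (closed) if it never ends on an external half-line: each of its strands
is continued, at both ends, by a strand of an internal line. The other faces are external (open). -/
def IsInternal (f : G.Face) : Prop :=
  ∀ ℓ c, G.face ℓ c = f →
    (∃ y, G.FaceStep (ℓ, c) y) ∧ (∃ y, G.FaceStep y (ℓ, c))

/-- The graph on the vertices whose edges are the lines in `H`. -/
def lineGraph (H : Set L) : SimpleGraph V :=
  SimpleGraph.fromRel fun v w => ∃ ℓ ∈ H, (G.src ℓ).1 = v ∧ (G.tgt ℓ).1 = w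

/-- A Feynman graph is connected if its vertices are connected by its lines. -/
def IsConnected : Prop := (G.lineGraph Set.univ).Connected

/-- A subgraph is a set `H` of lines together with the vertices attached to them. It is connected
if it is nonempty and its vertices are connected by its lines. -/
def IsConnectedSubgraph (H : Finset L) : Prop :=
  H.Nonempty ∧ ∀ ℓ ∈ H, ∀ ℓ' ∈ H, (G.lineGraph H).Reachable (G.src ℓ).1 (G.src ℓ').1

open Classical in
/-- The internal faces of a subgraph: the closed faces that run only through lines of `H`. -/
noncomputable def internalFaces [Finite L] (H : Finset L) : Finset G.Face :=
  {f | G.IsInternal f ∧ ∀ ℓ c, G.face ℓ c = f → ℓ ∈ H}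

open Classical in
/-- The incidence matrix `ε` of the lines and internal faces of the subgraph `H`. As every line is
oriented from `φ` to `φ̄`, lines and faces always have coherent orientations, so no sign occurs;
a face (of color `c`) runs at most once through a given line. -/
noncomputable def incidence [Finite L] (H : Finset L) :
    Matrix {ℓ // ℓ ∈ H} {f // f ∈ G.internalFaces H} ℚ :=
  fun ℓ f => if ∃ c, G.face ℓ.1 c = f.1 then 1 else 0

/-- The divergence degree `ω(H) = -2 L(H) + F(H) - R(H)`. -/
noncomputable def divergenceDegree [Finite L] (H : Finset L) : ℤ :=
  -2 * (H.card : ℤ) + ((G.internalFaces H).card : ℤ) - ((G.incidence H).rank : ℤ)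

/-- A graph is completely convergent if all its connected subgraphs (itself included) have
negative divergence degree. -/
def IsCompletelyConvergent [Finite L] : Prop :=
  ∀ H : Finset L, G.IsConnectedSubgraph H → G.divergenceDegree H < 0

/-- The propagator `C(p) = δ(∑ p_c) / (|p|² + m²)` in momentum space. -/
noncomputable def propagator (m : ℝ) (p : Fin 6 → ℤ) : ℝ :=
  if ∑ c, p c = 0 then 1 / (∑ c, (p c : ℝ) ^ 2 + m ^ 2) else 0

open Classical in
/-- The momenta of all faces, given those of the external and of the internal faces. -/
noncomputable def faceMomentum (pext : {f // ¬ G.IsInternal f} → ℤ)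
    (q : {f // G.IsInternal f} → ℤ) (f : G.Face) : ℤ :=
  if h : G.IsInternal f then q ⟨f, h⟩ else pext ⟨f, h⟩

/-- The product of the propagators of all internal lines at given momenta of the faces. -/
noncomputable def integrand [Fintype L] (m : ℝ) (pext : {f // ¬ G.IsInternal f} → ℤ)
    (q : {f // G.IsInternal f} → ℤ) : ℝ :=
  ∏ ℓ : L, propagator m fun c => G.faceMomentum pext q (G.face ℓ c)

/-- The (amputated) amplitude at fixed external momenta: the sum over the momenta of all internal
faces of the product of the propagators of all internal lines. -/
noncomputable def amplitude [Fintype L] (m : ℝ) (pext : {f // ¬ G.IsInternal f} → ℤ) : ℝ :=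
  ∑' q : {f // G.IsInternal f} → ℤ, G.integrand m pext q

end FeynmanGraph

/-! The five non-special strands of a bubble and the gauge constraint force two lines joined along a
corner of a bubble to carry the same momentum. The integrand is thus a function of one momentum per
*node*, a connected component of lines joined along corners. The momentum of an open node is fixed
by the external data, while a closed node with at least three lines contributes the convergent sum
`∑ C ^ 3`. The divergence degree is `dim ker ε - 2 L`, where `ker ε` is the space of closed momentum
flows satisfying the gauge constraint; counting the momenta of the closed nodes shows that complete
convergence leaves no closed node with one line, and none with two lines whose bubbles have the same
special color.

For a closed node with exactly two lines, `∑ C ^ 2` diverges, but each of its two bubbles glues one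
component of its momentum to that of another node. This links these nodes into chains, and by
convergence no chain is closed and self-contained. Along an oriented chain the
momenta are summed successively, with the component `p_c` shared with the previous node held fixed:
`∑_{p_c = x} C(p) ^ 2 √(E(p_c) / E(p_{c'})) ≤ K` uniformly in `x`, where `E(x) = √(x ^ 2 + m ^ 2)`.
The reverse orientation has the inverse energy ratios, so the arithmetic-geometric mean inequality
bounds the integrand by the mean of the two tilted products. -/

open scoped ENNReal

/-! ### Successive summation -/

theorem tsum_comp_mul_le_of_tsum_fibre_le {Ω β : Type*} (x : Ω → β) (f : β → ℝ≥0∞) (g : Ω → ℝ≥0∞)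
    {K : ℝ≥0∞} (hg : ∀ p ∈ Set.range x, ∑' ω : x ⁻¹' {p}, g ω ≤ K) :
    ∑' ω, f (x ω) * g ω ≤ (∑' p : Set.range x, f p) * K := by
  have hfibre (p : Set.range x) : Set.rangeFactorization x ⁻¹' {p} = x ⁻¹' {p.1} :=
    Set.ext fun ω => Subtype.ext_iff
  calc ∑' ω, f (x ω) * g ω
      = ∑' p : Set.range x, ∑' ω : x ⁻¹' {p.1}, f (x ω) * g ω := by
        refine (ENNReal.tsum_fiberwise _ (Set.rangeFactorization x)).symm.trans ?_
        exact tsum_congr fun p => tsum_congr_set_coe (fun ω => f (x ω) * g ω) (hfibre p)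
    _ = ∑' p : Set.range x, f p * ∑' ω : x ⁻¹' {p.1}, g ω := by
        refine tsum_congr fun p => ?_
        rw [← ENNReal.tsum_mul_left]
        refine tsum_congr fun ω => ?_
        rw [show x ω = p from ω.2]
    _ ≤ (∑' p : Set.range x, f p) * K := by
        rw [← ENNReal.tsum_mul_right]
        gcongr with p
        exact hg p p.2

theorem tsum_finset_prod_le_of_slice_le.{u} {I E α : Type*} [LinearOrder α] (r : I → α)
    (W : I → E → ℝ≥0∞) (K : I → ℝ≥0∞) (s : Finset I) : ∀ {Ω : Type u} (X : Ω → I → E),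
      (∀ ω ω', (∀ i ∈ s, X ω i = X ω' i) → ω = ω') →
      (∀ i ∈ s, ∀ ω, ∑' p : (fun ω' => X ω' i) '' {ω' | ∀ j ∈ s, r j < r i → X ω' j = X ω j},
        W i p ≤ K i) →
      ∑' ω, ∏ i ∈ s, W i (X ω i) ≤ ∏ i ∈ s, K i := by
  classical
  induction s using Finset.induction_on_min_value r with
  | empty =>
    intro Ω X hX _
    have : Subsingleton Ω := ⟨fun ω ω' => hX ω ω' (by simp)⟩
    simpa using ENNReal.tsum_comp_le_tsum_of_injective
      (f := fun _ : Ω => ()) (Function.injective_of_subsingleton _) fun _ => 1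
  | insert a s ha hmin ih =>
    intro Ω X hX hW
    rcases isEmpty_or_nonempty Ω with hΩ | ⟨⟨ω₀⟩⟩
    · simp
    have hfibre (p : E) : ∑' ω : (X · a) ⁻¹' {p}, ∏ i ∈ s, W i (X ω i) ≤ ∏ i ∈ s, K i := by
      have hval (ω : (X · a) ⁻¹' {p}) : X ω a = p := ω.2
      refine ih (fun (ω : (X · a) ⁻¹' {p}) i => X ω i) (fun ω ω' h => Subtype.ext <| hX _ _ ?_)
        fun i hi ω => (ENNReal.tsum_mono_subtype _ ?_).trans (hW i (Finset.mem_insert_of_mem hi) ω)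
      · simpa [hval] using h
      · rintro _ ⟨ω', hω', rfl⟩
        refine ⟨ω', fun j hj hji => ?_, rfl⟩
        rcases Finset.mem_insert.1 hj with rfl | hj
        · rw [hval, hval]
        · exact hω' j hj hji
    have hrange : ∑' p : Set.range (X · a), W a p ≤ K a := by
      refine (ENNReal.tsum_mono_subtype _ ?_).trans (hW a (Finset.mem_insert_self a s) ω₀)
      rintro _ ⟨ω, rfl⟩
      refine ⟨ω, fun j hj hja => (lt_irrefl _ (hja.trans_le ?_)).elim, rfl⟩
      rcases Finset.mem_insert.1 hj with rfl | hj
      exacts [le_rfl, hmin j hj]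
    simp only [Finset.prod_insert ha]
    exact (tsum_comp_mul_le_of_tsum_fibre_le (X · a) (W a) _ fun p _ => hfibre p).trans
      (mul_le_mul_left hrange _)

theorem tsum_prod_le_prod_of_slice_le {Ω I E α : Type*} [Fintype I] [LinearOrder α] (r : I → α)
    {X : Ω → I → E} (hX : Function.Injective X) {W : I → E → ℝ≥0∞} {K : I → ℝ≥0∞}
    (hW : ∀ i ω, ∑' p : (fun ω' => X ω' i) '' {ω' | ∀ j, r j < r i → X ω' j = X ω j}, W i p ≤ K i) :
    ∑' ω, ∏ i, W i (X ω i) ≤ ∏ i, K i := by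
  refine tsum_finset_prod_le_of_slice_le r W K Finset.univ X
    (fun _ _ h => hX <| funext fun i => h i (Finset.mem_univ i))
    fun i _ ω => (ENNReal.tsum_mono_subtype _ ?_).trans (hW i ω)
  rintro _ ⟨ω', hω', rfl⟩
  exact ⟨ω', fun j => hω' j (Finset.mem_univ j), rfl⟩

/-! ### One-particle sums over the momenta -/

theorem tsum_int_ofReal_le_of_telescoping {f : ℤ → ℝ} {g : ℕ → ℝ} (hf : ∀ n, 0 ≤ f n)
    (hf_even : ∀ n, f (-n) = f n) (hg : ∀ n, 0 ≤ g n)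
    (hfg : ∀ n : ℕ, f (n + 1) ≤ g n - g (n + 1)) :
    ∑' n, ENNReal.ofReal (f n) ≤ ENNReal.ofReal (f 0 + 2 * g 0) := by
  have hpos : ∑' n : ℕ, ENNReal.ofReal (f (n + 1)) ≤ ENNReal.ofReal (g 0) := by
    refine ENNReal.tsum_le_of_sum_range_le fun n => ?_
    rw [← ENNReal.ofReal_sum_of_nonneg fun i _ => hf _]
    refine ENNReal.ofReal_le_ofReal ?_
    calc ∑ i ∈ Finset.range n, f (i + 1) ≤ ∑ i ∈ Finset.range n, (g i - g (i + 1)) :=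
          Finset.sum_le_sum fun i _ => hfg i
      _ = g 0 - g n := Finset.sum_range_sub' g n
      _ ≤ g 0 := sub_le_self _ (hg n)
  have hsplit : ∑' n, ENNReal.ofReal (f n)
      = ENNReal.ofReal (f 0) + 2 * ∑' n : ℕ, ENNReal.ofReal (f (n + 1)) := by
    have h := (HasSum.of_nat_of_neg_add_one (f := fun n => ENNReal.ofReal (f n))
      ENNReal.summable.hasSum ENNReal.summable.hasSum).tsum_eq
    rw [h, tsum_eq_zero_add' (f := fun n : ℕ => ENNReal.ofReal (f n)) ENNReal.summable, two_mul,
      add_assoc]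
    simp only [hf_even, Nat.cast_zero, Nat.cast_add, Nat.cast_one]
  rw [hsplit, ENNReal.ofReal_add (hf 0) (by linarith [hg 0]), ENNReal.ofReal_mul zero_le_two,
    ENNReal.ofReal_ofNat]
  gcongr

/-- The relativistic energy `√(x² + m²)` of a particle of mass `m` and momentum `x`. -/
noncomputable def energy (m x : ℝ) : ℝ := √(x ^ 2 + m ^ 2)

section Energy

variable {m A : ℝ}

theorem energy_sq (m x : ℝ) : energy m x ^ 2 = x ^ 2 + m ^ 2 := Real.sq_sqrt (by positivity)

theorem energy_neg (m x : ℝ) : energy m (-x) = energy m x := by simp only [energy, neg_sq]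

theorem energy_zero (hm : 0 ≤ m) : energy m 0 = m := by simp [energy, Real.sqrt_sq hm]

theorem mass_le_energy (m x : ℝ) : m ≤ energy m x := Real.le_sqrt_of_sq_le (by nlinarith)

theorem le_energy (m x : ℝ) : x ≤ energy m x := Real.le_sqrt_of_sq_le (by nlinarith)

theorem energy_pos (hm : 0 < m) (x : ℝ) : 0 < energy m x := hm.trans_le (mass_le_energy m x)

theorem add_le_two_mul_energy (m x : ℝ) : m + x ≤ 2 * energy m x := by
  linarith [mass_le_energy m x, le_energy m x]

theorem tsum_int_inv_energy_sq_le (hm : 0 < m) (hA : m ≤ A) :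
    ∑' x : ℤ, ENNReal.ofReal ((energy A x)⁻¹ ^ 2) ≤ ENNReal.ofReal ((1 / m + 4) * A⁻¹) := by
  have hA0 : 0 < A := hm.trans_le hA
  refine (tsum_int_ofReal_le_of_telescoping (g := fun n => 2 * (A + n)⁻¹)
    (fun n => by positivity) (fun n => by simp [energy_neg]) (fun n => by positivity)
    fun n => ?_).trans (ENNReal.ofReal_le_ofReal ?_)
  · have htel : 2 * (A + n)⁻¹ - 2 * (A + (n + 1 : ℕ))⁻¹ = 2 / ((A + n) * (A + n + 1)) := by
      push_cast
      field_simp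
      ring
    rw [htel, inv_pow, energy_sq, inv_eq_one_div, div_le_div_iff₀ (by positivity) (by positivity)]
    push_cast
    nlinarith [sq_nonneg (A - (n + 1))]
  · have : (A⁻¹) ^ 2 ≤ 1 / m * A⁻¹ := by rw [sq, one_div]; gcongr
    simp only [Int.cast_zero, energy_zero hA0.le, Nat.cast_zero, add_zero]
    linarith

theorem inv_add_mul_inv_sqrt_le (hA : 0 < A) {y : ℝ} (hy : 0 ≤ y) :
    (A + (y + 1))⁻¹ * (√(y + 1))⁻¹ ≤ 4 * (√A + √y)⁻¹ - 4 * (√A + √(y + 1))⁻¹ := by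
  set a := √A
  set s := √y
  set t := √(y + 1)
  have hs : s ^ 2 = y := Real.sq_sqrt hy
  have ht : t ^ 2 = y + 1 := Real.sq_sqrt (by positivity)
  have ha : a ^ 2 = A := Real.sq_sqrt hA.le
  have ha0 : 0 < a := by positivity
  have ht0 : 0 < t := by positivity
  have hs0 : 0 ≤ s := by positivity
  have hst : s ≤ t := Real.sqrt_le_sqrt (by linarith)
  have hdiff : (2 * t)⁻¹ ≤ t - s := by
    have : t - s = (t + s)⁻¹ := by field_simp; linarith
    rw [this]
    gcongr
    linarith
  have hprod : (a + s) * (a + t) ≤ 2 * (a ^ 2 + t ^ 2) := by nlinarith [sq_nonneg (a - t)]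
  calc (A + (y + 1))⁻¹ * t⁻¹ = 4 * ((2 * t)⁻¹ * (2 * (a ^ 2 + t ^ 2))⁻¹) := by
        rw [← ha, ← ht]; field_simp; norm_num
    _ ≤ 4 * ((t - s) * ((a + s) * (a + t))⁻¹) := by gcongr
    _ = 4 * (a + s)⁻¹ - 4 * (a + t)⁻¹ := by field_simp; ring

theorem tsum_int_inv_energy_mul_inv_sqrt_energy_le (hm : 0 < m) (hA : m ≤ A) :
    ∑' x : ℤ, ENNReal.ofReal ((energy A x)⁻¹ * (√(energy m x))⁻¹)
      ≤ ENNReal.ofReal ((1 / m + 16) * (√A)⁻¹) := by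
  have hA0 : 0 < A := hm.trans_le hA
  refine (tsum_int_ofReal_le_of_telescoping (g := fun n => 8 * (√A + √n)⁻¹)
    (fun n => ?_) (fun n => by simp [energy_neg]) (fun n => by positivity)
    fun n => ?_).trans (ENNReal.ofReal_le_ofReal ?_)
  · have := energy_pos hA0 n
    positivity
  · have hA' : (energy A (n + 1))⁻¹ ≤ 2 * (A + (n + 1))⁻¹ := by
      have := energy_pos hA0 (n + 1)
      rw [← inv_inv (2 : ℝ), ← mul_inv]
      gcongr
      linarith [add_le_two_mul_energy A (n + 1)]
    have hm' : (√(energy m (n + 1)))⁻¹ ≤ (√(n + 1 : ℝ))⁻¹ := by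
      gcongr
      exact le_energy m _
    push_cast
    calc (energy A (n + 1))⁻¹ * (√(energy m (n + 1)))⁻¹
        ≤ 2 * (A + (n + 1))⁻¹ * (√(n + 1 : ℝ))⁻¹ := by gcongr
      _ ≤ 8 * (√A + √n)⁻¹ - 8 * (√A + √(n + 1))⁻¹ := by
        linarith [inv_add_mul_inv_sqrt_le hA0 (y := n) (by positivity)]
  · have : A⁻¹ * (√m)⁻¹ ≤ 1 / m * (√A)⁻¹ := by
      rw [one_div, ← mul_inv, ← mul_inv]
      refine inv_anti₀ (by positivity) ?_
      calc m * √A = √m * √m * √A := by rw [Real.mul_self_sqrt hm.le]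
        _ ≤ √A * √m * √A := by gcongr
        _ = A * √m := by rw [mul_right_comm, Real.mul_self_sqrt hA0.le]
    simp only [Int.cast_zero, energy_zero hA0.le, energy_zero hm.le, Nat.cast_zero, Real.sqrt_zero,
      add_zero]
    linarith

theorem tsum_option_sum_sq_add_sq {ι : Type*} [Fintype ι] (F : ℝ → ℝ≥0∞) (A : ℝ) :
    ∑' u : Option ι → ℤ, F (∑ i, (u i : ℝ) ^ 2 + A ^ 2)
      = ∑' x : ℤ, ∑' u : ι → ℤ, F (∑ i, (u i : ℝ) ^ 2 + energy A x ^ 2) := by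
  rw [← (Equiv.piOptionEquivProd (β := fun _ => ℤ)).symm.tsum_eq, ENNReal.tsum_prod']
  refine tsum_congr fun x => tsum_congr fun u => congrArg F ?_
  simp only [Fintype.sum_option, energy_sq, Equiv.piOptionEquivProd_symm_apply]
  ring

theorem tsum_inv_sqrt_add_sum_sq_pow_le {ι : Type*} [Fintype ι] (hm : 0 < m) (k : ℕ) (hA : m ≤ A) :
    ∑' u : ι → ℤ, ENNReal.ofReal
        ((√(∑ i, (u i : ℝ) ^ 2 + A ^ 2))⁻¹ ^ (Fintype.card ι + k + 1))
      ≤ ENNReal.ofReal ((1 / m + 4) ^ Fintype.card ι * A⁻¹ ^ (k + 1)) := by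
  refine Fintype.induction_empty_option (P := fun ι _ => ∀ (k : ℕ) (A : ℝ), m ≤ A →
    ∑' u : ι → ℤ, ENNReal.ofReal ((√(∑ i, (u i : ℝ) ^ 2 + A ^ 2))⁻¹ ^ (Fintype.card ι + k + 1))
      ≤ ENNReal.ofReal ((1 / m + 4) ^ Fintype.card ι * A⁻¹ ^ (k + 1))) ?_ ?_ ?_ ι k A hA
  · intro α β _ e ih k A hA
    let _ := Fintype.ofEquiv β e.symm
    rw [← (e.arrowCongr (.refl ℤ)).tsum_eq, ← Fintype.card_congr e]
    convert ih k A hA using 5 with u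
    simp [← e.sum_comp]
  · intro k A hA
    simp [Real.sqrt_sq (hm.le.trans hA)]
  · intro ι _ ih k A hA
    have hA0 : 0 < A := hm.trans_le hA
    have hinner (x : ℤ) :
        ∑' u : ι → ℤ, ENNReal.ofReal ((√(∑ i, (u i : ℝ) ^ 2 + energy A x ^ 2))⁻¹
            ^ (Fintype.card ι + (k + 1) + 1))
          ≤ ENNReal.ofReal ((1 / m + 4) ^ Fintype.card ι * A⁻¹ ^ k)
            * ENNReal.ofReal ((energy A x)⁻¹ ^ 2) := by
      have := energy_pos hA0 x
      refine (ih (k + 1) _ (hA.trans (mass_le_energy A x))).trans ?_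
      rw [← ENNReal.ofReal_mul (by positivity), mul_assoc, add_assoc, pow_add]
      gcongr
      exact mass_le_energy A x
    calc _ = ∑' x : ℤ, ∑' u : ι → ℤ, ENNReal.ofReal
            ((√(∑ i, (u i : ℝ) ^ 2 + energy A x ^ 2))⁻¹ ^ (Fintype.card ι + (k + 1) + 1)) := by
          have hexp : Fintype.card (Option ι) + k + 1 = Fintype.card ι + (k + 1) + 1 := by
            rw [Fintype.card_option]
            ring
          rw [hexp]
          exact tsum_option_sum_sq_add_sq
            (fun y => ENNReal.ofReal ((√y)⁻¹ ^ (Fintype.card ι + (k + 1) + 1))) A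
      _ ≤ ENNReal.ofReal ((1 / m + 4) ^ Fintype.card ι * A⁻¹ ^ k)
            * ENNReal.ofReal ((1 / m + 4) * A⁻¹) := by
          refine (ENNReal.tsum_le_tsum hinner).trans ?_
          rw [ENNReal.tsum_mul_left]
          gcongr
          exact tsum_int_inv_energy_sq_le hm hA
      _ = _ := by
          rw [← ENNReal.ofReal_mul (by positivity), Fintype.card_option]
          congr 1
          ring

theorem tsum_prod_inv_sqrt_pow_mul_inv_sqrt_energy_le {ι : Type*} [Fintype ι] (hm : 0 < m)
    (hA : m ≤ A) :
    ∑' v : ℤ × (ι → ℤ), ENNReal.ofReal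
        ((√(∑ i, (v.2 i : ℝ) ^ 2 + energy A v.1 ^ 2))⁻¹ ^ (Fintype.card ι + 1)
          * (√(energy m v.1))⁻¹)
      ≤ ENNReal.ofReal ((1 / m + 4) ^ Fintype.card ι * (1 / m + 16) * (√A)⁻¹) := by
  have hinner (y : ℤ) : ∑' u : ι → ℤ, ENNReal.ofReal
      ((√(∑ i, (u i : ℝ) ^ 2 + energy A y ^ 2))⁻¹ ^ (Fintype.card ι + 1))
        ≤ ENNReal.ofReal ((1 / m + 4) ^ Fintype.card ι) * ENNReal.ofReal (energy A y)⁻¹ := by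
    rw [← ENNReal.ofReal_mul (by positivity)]
    simpa using tsum_inv_sqrt_add_sum_sq_pow_le (ι := ι) hm 0 (hA.trans (mass_le_energy A y))
  calc _ = ∑' y : ℤ, (∑' u : ι → ℤ, ENNReal.ofReal
            ((√(∑ i, (u i : ℝ) ^ 2 + energy A y ^ 2))⁻¹ ^ (Fintype.card ι + 1)))
            * ENNReal.ofReal (√(energy m y))⁻¹ := by
        rw [ENNReal.tsum_prod']
        refine tsum_congr fun y => ?_
        rw [← ENNReal.tsum_mul_right]
        exact tsum_congr fun u => ENNReal.ofReal_mul (by positivity)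
    _ ≤ ∑' y : ℤ, ENNReal.ofReal ((1 / m + 4) ^ Fintype.card ι)
          * ENNReal.ofReal ((energy A y)⁻¹ * (√(energy m y))⁻¹) := by
        refine ENNReal.tsum_le_tsum fun y => ?_
        have := energy_pos (hm.trans_le hA) y
        rw [ENNReal.ofReal_mul (by positivity), ← mul_assoc]
        gcongr
        exact hinner y
    _ ≤ ENNReal.ofReal ((1 / m + 4) ^ Fintype.card ι)
          * ENNReal.ofReal ((1 / m + 16) * (√A)⁻¹) := by
        rw [ENNReal.tsum_mul_left]
        gcongr
        exact tsum_int_inv_energy_mul_inv_sqrt_energy_le hm hA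
    _ = _ := by
        rw [← ENNReal.ofReal_mul (by positivity), mul_assoc]

end Energy

namespace FeynmanGraph

section Propagator

variable {m : ℝ}

theorem propagator_nonneg (m : ℝ) (p : Fin 6 → ℤ) : 0 ≤ propagator m p := by
  unfold propagator; split_ifs <;> positivity

theorem sum_eq_zero_of_propagator_ne_zero {p : Fin 6 → ℤ} (h : propagator m p ≠ 0) :
    ∑ c, p c = 0 := by
  by_contra h'
  exact h (if_neg h')

theorem propagator_le_inv {p : Fin 6 → ℤ} {e : ℝ} (he : 0 < e)
    (hp : e ≤ ∑ c, (p c : ℝ) ^ 2 + m ^ 2) : propagator m p ≤ e⁻¹ := by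
  unfold propagator
  split_ifs
  · rw [one_div]
    gcongr
  · positivity

theorem propagator_pow_le_inv_sqrt_pow {p : Fin 6 → ℤ} {e : ℝ} (he : 0 < e)
    (hp : e ≤ ∑ c, (p c : ℝ) ^ 2 + m ^ 2) (n : ℕ) : propagator m p ^ n ≤ (√e)⁻¹ ^ (2 * n) := by
  rw [pow_mul, inv_pow, Real.sq_sqrt he.le]
  exact pow_le_pow_left₀ (propagator_nonneg m p) (propagator_le_inv he hp) n

theorem eq_of_sum_eq_zero {ι M : Type*} [Fintype ι] [AddCommGroup M] {p p' : ι → M}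
    (hp : ∑ c, p c = 0) (hp' : ∑ c, p' c = 0) {c₀ : ι} (h : ∀ c, c ≠ c₀ → p c = p' c) : p = p' := by
  classical
  funext c
  by_cases hc : c = c₀
  · subst hc
    rw [← Finset.add_sum_erase _ _ (Finset.mem_univ c)] at hp hp'
    rw [Finset.sum_congr rfl fun c' hc' => h c' (Finset.ne_of_mem_erase hc'), ← hp'] at hp
    exact add_right_cancel hp
  · exact h c hc

theorem tsum_propagator_cube_le (hm : 0 < m) :
    ∑' p : {p : Fin 6 → ℤ | ∑ c, p c = 0}, ENNReal.ofReal (propagator m p ^ 3)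
      ≤ ENNReal.ofReal ((1 / m + 4) ^ 5 * m⁻¹) := by
  let restrict (p : {p : Fin 6 → ℤ | ∑ c, p c = 0}) (i : {c : Fin 6 // c ≠ 0}) : ℤ := p.1 i
  have hinj : Function.Injective restrict := fun p p' h =>
    Subtype.ext <| eq_of_sum_eq_zero p.2 p'.2 fun c hc => congrFun h ⟨c, hc⟩
  have hcard : Fintype.card {c : Fin 6 // c ≠ 0} = 5 := rfl
  have hsum := tsum_inv_sqrt_add_sum_sq_pow_le (ι := {c : Fin 6 // c ≠ 0}) hm 0 le_rfl
  rw [hcard, zero_add, pow_one] at hsum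
  refine le_trans (ENNReal.tsum_le_tsum fun p => ENNReal.ofReal_le_ofReal ?_)
    ((ENNReal.tsum_comp_le_tsum_of_injective hinj _).trans hsum)
  refine propagator_pow_le_inv_sqrt_pow (by positivity) ?_ 3
  gcongr
  rw [← Fintype.sum_subtype_add_sum_subtype (fun c : Fin 6 => c ≠ 0)]
  exact le_add_of_nonneg_right (Finset.sum_nonneg fun _ _ => sq_nonneg _)

theorem tsum_propagator_sq_mul_sqrt_energy_div_le (hm : 0 < m) {c c' : Fin 6} (hc : c ≠ c')
    (x : ℤ) :
    ∑' p : {p : Fin 6 → ℤ | ∑ c, p c = 0 ∧ p c = x},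
        ENNReal.ofReal (propagator m p ^ 2 * √(energy m (p.1 c) / energy m (p.1 c')))
      ≤ ENNReal.ofReal ((1 / m + 4) ^ 3 * (1 / m + 16)) := by
  obtain ⟨c'', hc'', hcc''⟩ : ∃ c'', c'' ≠ c ∧ c'' ≠ c' := by decide +revert
  let s : Finset (Fin 6) := {c, c', c''}
  have hA0 := energy_pos hm x
  let split (p : {p : Fin 6 → ℤ | ∑ c, p c = 0 ∧ p c = x}) : ℤ × ((sᶜ : Finset (Fin 6)) → ℤ) :=
    (p.1 c', fun i => p.1 i)
  have hinj : Function.Injective split := by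
    intro p p' h
    refine Subtype.ext <| eq_of_sum_eq_zero p.2.1 p'.2.1 (c₀ := c'') fun d hd => ?_
    by_cases hds : d ∈ s
    · obtain rfl | rfl : d = c ∨ d = c' := by simpa [s, hd] using hds
      exacts [p.2.2.trans p'.2.2.symm, congrArg Prod.fst h]
    · exact congrFun (congrArg Prod.snd h) ⟨d, Finset.mem_compl.2 hds⟩
  have hcard : Fintype.card (sᶜ : Finset (Fin 6)) = 3 := by
    rw [Fintype.card_coe, Finset.card_compl,
      Finset.card_eq_three.2 ⟨c, c', c'', hc, hc''.symm, hcc''.symm, rfl⟩, Fintype.card_fin]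
  have hsum := tsum_prod_inv_sqrt_pow_mul_inv_sqrt_energy_le (ι := (sᶜ : Finset (Fin 6))) hm
    (mass_le_energy m x)
  rw [hcard] at hsum
  calc _ ≤ ∑' p, ENNReal.ofReal √(energy m x) * ENNReal.ofReal
          ((√(∑ i, ((split p).2 i : ℝ) ^ 2 + energy (energy m x) (split p).1 ^ 2))⁻¹ ^ (3 + 1)
            * (√(energy m (split p).1))⁻¹) := by
        refine ENNReal.tsum_le_tsum fun p => ?_
        rw [← ENNReal.ofReal_mul (by positivity), p.2.2, Real.sqrt_div hA0.le, div_eq_mul_inv,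
          mul_left_comm]
        refine ENNReal.ofReal_le_ofReal ?_
        gcongr
        refine propagator_pow_le_inv_sqrt_pow (by have := energy_pos hA0 (p.1 c'); positivity) ?_ 2
        rw [energy_sq, energy_sq, ← Finset.sum_compl_add_sum s fun d => (p.1 d : ℝ) ^ 2,
          ← Finset.sum_coe_sort sᶜ, Finset.sum_insert (by simp [hc, hc''.symm]),
          Finset.sum_pair hcc''.symm, p.2.2]
        linarith [sq_nonneg (p.1 c'' : ℝ)]
    _ ≤ ENNReal.ofReal √(energy m x) * ENNReal.ofReal
          ((1 / m + 4) ^ 3 * (1 / m + 16) * (√(energy m x))⁻¹) := by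
        rw [ENNReal.tsum_mul_left]
        gcongr
        exact (ENNReal.tsum_comp_le_tsum_of_injective hinj _).trans hsum
    _ = _ := by
        rw [← ENNReal.ofReal_mul (by positivity)]
        congr 1
        field_simp

end Propagator

/-! ### Closed flows and the divergence degree -/

variable {V L : Type*} (G : FeynmanGraph V L)

section ClosedFlows

/-- The closed flows through a set `H` of lines: families of rational momenta of the lines,
vanishing off `H`, which are constant along the faces, vanish on the external faces and obey the
gauge constraint `∑ p_c = 0` on every line. -/
def closedFlows (H : Finset L) : Submodule ℚ (L → Fin 6 → ℚ) where
  carrier := {y | (∀ ℓ ∉ H, y ℓ = 0) ∧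
    (∀ s t : L × Fin 6, G.FaceStep s t → y s.1 s.2 = y t.1 t.2) ∧
    (∀ s : L × Fin 6, ¬((∃ t, G.FaceStep s t) ∧ ∃ t, G.FaceStep t s) → y s.1 s.2 = 0) ∧
    ∀ ℓ, ∑ c, y ℓ c = 0}
  zero_mem' := by simp
  add_mem' := fun {y y'} hy hy' => by
    refine ⟨fun ℓ hℓ => ?_, fun s t h => ?_, fun s h => ?_, fun ℓ => ?_⟩
    · rw [Pi.add_apply, hy.1 ℓ hℓ, hy'.1 ℓ hℓ, add_zero]
    · simp only [Pi.add_apply, hy.2.1 s t h, hy'.2.1 s t h]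
    · simp only [Pi.add_apply, hy.2.2.1 s h, hy'.2.2.1 s h, add_zero]
    · simp only [Pi.add_apply, Finset.sum_add_distrib, hy.2.2.2 ℓ, hy'.2.2.2 ℓ, add_zero]
  smul_mem' := fun a y hy => by
    refine ⟨fun ℓ hℓ => ?_, fun s t h => ?_, fun s h => ?_, fun ℓ => ?_⟩
    · rw [Pi.smul_apply, hy.1 ℓ hℓ, smul_zero]
    · simp only [Pi.smul_apply, hy.2.1 s t h]
    · simp only [Pi.smul_apply, hy.2.2.1 s h, smul_zero]
    · simp only [Pi.smul_apply, ← Finset.smul_sum, hy.2.2.2 ℓ, smul_zero]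

variable {G} {H : Finset L} {y : L → Fin 6 → ℚ}

theorem eq_of_face_eq_of_mem_closedFlows (hy : y ∈ G.closedFlows H) {ℓ ℓ' : L} {c c' : Fin 6}
    (h : G.face ℓ c = G.face ℓ' c') : y ℓ c = y ℓ' c' :=
  congrArg (Quot.lift (fun s : L × Fin 6 => y s.1 s.2) hy.2.1) h

theorem face_injective (ℓ : L) : Function.Injective (G.face ℓ) := fun _ _ h =>
  congrArg (Quot.lift Prod.snd fun _ _ h => h.1 : G.Face → Fin 6) h

variable [Finite L]

theorem mem_internalFaces {f : G.Face} : f ∈ G.internalFaces H ↔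
    G.IsInternal f ∧ ∀ ℓ c, G.face ℓ c = f → ℓ ∈ H := by
  simp only [internalFaces, Finset.mem_filter, Finset.mem_univ, true_and]

theorem eq_zero_of_notMem_internalFaces (hy : y ∈ G.closedFlows H) {ℓ : L} {c : Fin 6}
    (h : G.face ℓ c ∉ G.internalFaces H) : y ℓ c = 0 := by
  simp only [mem_internalFaces, IsInternal, not_and_or, not_forall, exists_prop] at h
  rcases h with ⟨ℓ', c', hf, h⟩ | ⟨ℓ', c', hf, h⟩
  · rw [eq_of_face_eq_of_mem_closedFlows hy hf.symm]
    exact hy.2.2.1 (ℓ', c') (by rwa [not_and_or])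
  · rw [eq_of_face_eq_of_mem_closedFlows hy hf.symm, hy.1 ℓ' h, Pi.zero_apply]

open Classical in
theorem incidence_mulVec_apply (g : {f // f ∈ G.internalFaces H} → ℚ) (ℓ : {ℓ // ℓ ∈ H}) :
    (G.incidence H).mulVec g ℓ
      = ∑ c, if h : G.face ℓ.1 c ∈ G.internalFaces H then g ⟨_, h⟩ else 0 := by
  have hentry (f : {f // f ∈ G.internalFaces H}) :
      G.incidence H ℓ f * g f = ∑ c, if G.face ℓ.1 c = f.1 then g f else 0 := by
    by_cases hf : ∃ c, G.face ℓ.1 c = f.1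
    · obtain ⟨c, hc⟩ := id hf
      rw [incidence, if_pos hf, one_mul, Finset.sum_eq_single c _ (by simp), if_pos hc]
      exact fun c' _ hc' => if_neg fun h => hc' (G.face_injective ℓ.1 (h.trans hc.symm))
    · rw [incidence, if_neg hf, zero_mul, eq_comm]
      exact Finset.sum_eq_zero fun c _ => if_neg fun h => hf ⟨c, h⟩
  simp only [Matrix.mulVec, dotProduct, hentry]
  rw [Finset.sum_comm]
  refine Finset.sum_congr rfl fun c _ => ?_
  split_ifs with hc
  · rw [Finset.sum_eq_single ⟨_, hc⟩ (fun f _ hf => if_neg fun h => hf (Subtype.ext h.symm))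
      (by simp), if_pos rfl]
  · exact Finset.sum_eq_zero fun f _ => if_neg fun h : G.face ℓ.1 c = f.1 => hc (h ▸ f.2)

/-- The family of momenta of the internal faces of `H` that a closed flow through `H` defines. It is
read off one chosen strand of each face, so that it is linear on all families of momenta. -/
noncomputable def faceFlow (H : Finset L) :
    (L → Fin 6 → ℚ) →ₗ[ℚ] ({f // f ∈ G.internalFaces H} → ℚ) :=
  LinearMap.pi fun f => LinearMap.proj (Quot.out f.1).2 ∘ₗ LinearMap.proj (Quot.out f.1).1

theorem faceFlow_apply (hy : y ∈ G.closedFlows H) {ℓ : L} {c : Fin 6}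
    (h : G.face ℓ c ∈ G.internalFaces H) : faceFlow H y ⟨_, h⟩ = y ℓ c :=
  eq_of_face_eq_of_mem_closedFlows hy (Quot.out_eq _)

theorem faceFlow_mem_ker_incidence (hy : y ∈ G.closedFlows H) :
    faceFlow H y ∈ LinearMap.ker (G.incidence H).mulVecLin := by
  rw [LinearMap.mem_ker, Matrix.mulVecLin_apply]
  ext ℓ
  rw [incidence_mulVec_apply, Pi.zero_apply]
  refine Eq.trans ?_ (hy.2.2.2 ℓ)
  refine Finset.sum_congr rfl fun c _ => ?_
  split_ifs with hc
  · exact faceFlow_apply hy hc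
  · exact (eq_zero_of_notMem_internalFaces hy hc).symm

theorem faceFlow_injOn : Set.InjOn (faceFlow (G := G) H) (G.closedFlows H) := by
  intro y hy y' hy' h
  funext ℓ c
  by_cases hc : G.face ℓ c ∈ G.internalFaces H
  · rw [← faceFlow_apply hy hc, h, faceFlow_apply hy' hc]
  · rw [eq_zero_of_notMem_internalFaces hy hc, eq_zero_of_notMem_internalFaces hy' hc]

theorem finrank_closedFlows_le (H : Finset L) :
    (Module.finrank ℚ (G.closedFlows H) : ℤ) ≤ 2 * H.card + G.divergenceDegree H := by
  have hinj : Function.Injective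
      ((faceFlow H).restrict fun _ => faceFlow_mem_ker_incidence (G := G) (H := H)) :=
    fun y y' h => Subtype.ext (faceFlow_injOn y.2 y'.2 (congrArg Subtype.val h))
  have hrank := LinearMap.finrank_range_add_finrank_ker (G.incidence H).mulVecLin
  rw [Module.finrank_fintype_fun_eq_card, Fintype.card_coe] at hrank
  have := LinearMap.finrank_le_finrank_of_injective hinj
  rw [divergenceDegree, Matrix.rank]
  omega

end ClosedFlows

/-! ### Nodes -/

section Nodes

/-- The other half-line of the same type (`φ` or `φ̄`) in a bubble. -/
def opposite {V : Type*} (h : V × Bool) : V × Bool := (h.1, !h.2)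

theorem opposite_opposite {V : Type*} (h : V × Bool) : opposite (opposite h) = h := by
  simp [opposite]

theorem opposite_ne {V : Type*} (h : V × Bool) : opposite h ≠ h := fun heq =>
  Bool.not_ne_self h.2 (congrArg Prod.snd heq)

variable {V L : Type*} (G : FeynmanGraph V L)

theorem strand_of_ne {c : Fin 6} {h : V × Bool} (hc : c ≠ G.color h.1) : G.strand c h = h := by
  simp [strand, hc]

theorem strand_color (h : V × Bool) : G.strand (G.color h.1) h = opposite h := by
  simp [strand, opposite]

theorem strand_strand (c : Fin 6) (h : V × Bool) : G.strand c (G.strand c h) = h := by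
  obtain hc | rfl := ne_or_eq c (G.color h.1)
  · rw [G.strand_of_ne hc, G.strand_of_ne hc]
  · rw [G.strand_color, show G.color h.1 = G.color (opposite h).1 from rfl, G.strand_color,
      opposite_opposite]

/-- The line `ℓ` is followed by the line `ℓ'` along a corner of a bubble: they share there the
strands of the five colors other than the special one. -/
def LineStep (ℓ ℓ' : L) : Prop := G.tgt ℓ = G.src ℓ'

/-- The connected components of the lines joined along the corners of the bubbles. The gauge
constraint makes all the lines of a node carry the same momentum. -/
def Node : Type _ := Quot G.LineStep

/-- The node of a line. -/
def node (ℓ : L) : G.Node := Quot.mk _ ℓ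

/-- A node is closed if each of its lines is continued at both ends along a corner. -/
def IsClosedNode (C : G.Node) : Prop :=
  ∀ ℓ, G.node ℓ = C → (∃ ℓ', G.LineStep ℓ ℓ') ∧ ∃ ℓ', G.LineStep ℓ' ℓ

theorem node_surjective : Function.Surjective G.node := Quot.mk_surjective

noncomputable instance [Finite L] : Fintype G.Node :=
  @Fintype.ofFinite _ (Finite.of_surjective _ G.node_surjective)

open Classical in
/-- The lines of the nodes in `J`. -/
noncomputable def linesOf [Fintype L] (J : Finset G.Node) : Finset L := {ℓ | G.node ℓ ∈ J}

variable {G} {ℓ ℓ' : L}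

theorem mem_linesOf [Fintype L] {J : Finset G.Node} : ℓ ∈ G.linesOf J ↔ G.node ℓ ∈ J := by
  simp only [linesOf, Finset.mem_filter, Finset.mem_univ, true_and]

theorem card_linesOf [Fintype L] (J : Finset G.Node) :
    (G.linesOf J).card = ∑ C ∈ J, (G.linesOf {C}).card := by
  classical
  rw [Finset.card_eq_sum_card_fiberwise (f := G.node) (t := J) fun ℓ => mem_linesOf.1]
  refine Finset.sum_congr rfl fun C hC => congrArg Finset.card (Finset.ext fun ℓ => ?_)
  simp only [Finset.mem_filter, mem_linesOf, Finset.mem_singleton, and_iff_right_iff_imp]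
  exact fun h => h ▸ hC

theorem LineStep.node_eq (h : G.LineStep ℓ ℓ') : G.node ℓ = G.node ℓ' := Quot.sound h

theorem faceStep_of_ne {c : Fin 6} (h : c ≠ G.color (G.tgt ℓ).1) :
    G.FaceStep (ℓ, c) (ℓ', c) ↔ G.LineStep ℓ ℓ' := by
  simp only [FaceStep, G.strand_of_ne h, LineStep, true_and]

theorem faceStep_color :
    G.FaceStep (ℓ, G.color (G.tgt ℓ).1) (ℓ', G.color (G.tgt ℓ).1) ↔
      opposite (G.tgt ℓ) = G.src ℓ' := by
  simp only [FaceStep, G.strand_color, true_and]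

theorem reachable_src_tgt {H : Set L} (h : ℓ ∈ H) :
    (G.lineGraph H).Reachable (G.src ℓ).1 (G.tgt ℓ).1 := by
  by_cases heq : (G.src ℓ).1 = (G.tgt ℓ).1
  · rw [heq]
  · exact ((SimpleGraph.fromRel_adj _ _ _).2 ⟨heq, Or.inl ⟨ℓ, h, rfl, rfl⟩⟩).reachable

theorem reachable_of_node_eq [Fintype L] {J : Finset G.Node} (h : G.node ℓ = G.node ℓ')
    (hJ : G.node ℓ ∈ J) : (G.lineGraph (G.linesOf J)).Reachable (G.src ℓ).1 (G.src ℓ').1 := by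
  induction Quot.eqvGen_exact h with
  | rel x y hxy =>
    have hreach := reachable_src_tgt (G := G) (H := G.linesOf J) (mem_linesOf.2 hJ)
    rwa [show G.tgt x = G.src y from hxy] at hreach
  | refl x => rfl
  | symm x y _ ih => exact (ih h.symm (h ▸ hJ)).symm
  | trans x y z hxy _ ih₁ ih₂ =>
    have hnode : G.node x = G.node y := Quot.eqvGen_sound hxy
    exact (ih₁ hnode hJ).trans (ih₂ (hnode.symm.trans h) (hnode ▸ hJ))

end Nodes

section Corners

variable {V L : Type*} {G : FeynmanGraph V L}

open Classical in
/-- The momentum of the corners of the bubbles, indexed by their `φ̄` half-line, when the lines of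
the node `C` carry the momentum `x C`; it vanishes at the external half-lines. -/
noncomputable def cornerMomentum (x : G.Node → Fin 6 → ℚ) : V × Bool → Fin 6 → ℚ :=
  Function.extend G.tgt (x ∘ G.node) 0

theorem cornerMomentum_tgt (x : G.Node → Fin 6 → ℚ) (ℓ : L) :
    cornerMomentum x (G.tgt ℓ) = x (G.node ℓ) :=
  G.tgt_injective.extend_apply _ _ ℓ

theorem cornerMomentum_of_notMem_range (x : G.Node → Fin 6 → ℚ) {h : V × Bool}
    (hh : ¬ ∃ ℓ, G.tgt ℓ = h) : cornerMomentum x h = 0 :=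
  Function.extend_apply' _ _ h hh

variable {x : G.Node → Fin 6 → ℚ}

theorem cornerMomentum_src (hx : ∀ C, ¬ G.IsClosedNode C → x C = 0) (ℓ : L) :
    cornerMomentum x (G.src ℓ) = x (G.node ℓ) := by
  by_cases h : ∃ ℓ', G.tgt ℓ' = G.src ℓ
  · obtain ⟨ℓ', h⟩ := h
    rw [← h, cornerMomentum_tgt, LineStep.node_eq h]
  · rw [cornerMomentum_of_notMem_range x h, hx _ fun hclosed => h (hclosed ℓ rfl).2]

theorem cornerMomentum_eq_zero (hx : ∀ C, ¬ G.IsClosedNode C → x C = 0) {h : V × Bool}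
    (hh : ¬ ∃ ℓ, G.src ℓ = h) : cornerMomentum x h = 0 := by
  by_cases htgt : ∃ ℓ, G.tgt ℓ = h
  · obtain ⟨ℓ, rfl⟩ := htgt
    rw [cornerMomentum_tgt, hx _ fun hclosed => hh ?_]
    exact (hclosed ℓ rfl).1.imp fun _ => Eq.symm
  · exact cornerMomentum_of_notMem_range x htgt

theorem cornerMomentum_strand
    (hglue : ∀ ℓ, x (G.node ℓ) ≠ 0 → cornerMomentum x (opposite (G.tgt ℓ)) (G.color (G.tgt ℓ).1)
      = x (G.node ℓ) (G.color (G.tgt ℓ).1)) (c : Fin 6) (h : V × Bool) :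
    cornerMomentum x (G.strand c h) c = cornerMomentum x h c := by
  have hglue' (h : V × Bool) (hh : cornerMomentum x h ≠ 0) :
      cornerMomentum x (opposite h) (G.color h.1) = cornerMomentum x h (G.color h.1) := by
    obtain ⟨ℓ, rfl⟩ := not_imp_comm.1 (cornerMomentum_of_notMem_range x) hh
    rw [cornerMomentum_tgt] at hh ⊢
    exact hglue ℓ hh
  obtain hc | rfl := ne_or_eq c (G.color h.1)
  · rw [G.strand_of_ne hc]
  rw [G.strand_color]
  by_cases hh : cornerMomentum x h = 0
  · by_cases hh' : cornerMomentum x (opposite h) = 0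
    · rw [hh, hh']
    · have hopp := hglue' _ hh'
      rw [opposite_opposite] at hopp
      exact hopp.symm
  · exact hglue' h hh

theorem comp_node_mem_closedFlows [Fintype L] {J : Finset G.Node}
    (hJ : ∀ C ∈ J, G.IsClosedNode C) (hx : ∀ C ∉ J, x C = 0) (hgauge : ∀ C, ∑ c, x C c = 0)
    (hglue : ∀ ℓ, G.node ℓ ∈ J → cornerMomentum x (opposite (G.tgt ℓ)) (G.color (G.tgt ℓ).1)
      = x (G.node ℓ) (G.color (G.tgt ℓ).1)) :
    x ∘ G.node ∈ G.closedFlows (G.linesOf J) := by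
  have hopen (C : G.Node) (hC : ¬ G.IsClosedNode C) : x C = 0 := hx C fun h => hC (hJ C h)
  have hstrand := cornerMomentum_strand fun ℓ hℓ => hglue ℓ (not_imp_comm.1 (hx _) hℓ)
  refine ⟨fun ℓ hℓ => hx _ (mt mem_linesOf.2 hℓ), fun ⟨ℓ, c⟩ ⟨ℓ', c'⟩ h => ?_,
    fun ⟨ℓ, c⟩ h => ?_, fun ℓ => hgauge _⟩
  · obtain ⟨rfl, h⟩ : c = c' ∧ G.strand c (G.tgt ℓ) = G.src ℓ' := h
    rw [Function.comp_apply, ← cornerMomentum_tgt x ℓ, ← hstrand, h, cornerMomentum_src hopen,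
      Function.comp_apply]
  · rcases not_and_or.1 h with h | h
    · have hend : ¬ ∃ ℓ', G.src ℓ' = G.strand c (G.tgt ℓ) := fun ⟨ℓ', h'⟩ =>
        h ⟨(ℓ', c), rfl, h'.symm⟩
      rw [Function.comp_apply, ← cornerMomentum_tgt x ℓ, ← hstrand,
        cornerMomentum_eq_zero hopen hend, Pi.zero_apply]
    · have hend : ¬ ∃ ℓ', G.tgt ℓ' = G.strand c (G.src ℓ) := fun ⟨ℓ', h'⟩ =>
        h ⟨(ℓ', c), rfl, by rw [h', strand_strand]⟩
      rw [Function.comp_apply, ← cornerMomentum_src hopen ℓ, ← hstrand,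
        cornerMomentum_of_notMem_range x hend, Pi.zero_apply]

open Classical in
/-- A family of momenta of the closed nodes in `J` has five free components for each node, and it is
a closed flow once the `|Q|` linear constraints `t q` make it pass through the bubbles. -/
theorem five_mul_card_le [Fintype L] {J : Finset G.Node} (hJ : ∀ C ∈ J, G.IsClosedNode C)
    {Q : Type*} [Fintype Q] (t : Q → (G.Node → Fin 6 → ℚ) →ₗ[ℚ] ℚ)
    (ht : ∀ x : G.Node → Fin 6 → ℚ, (∀ C ∉ J, x C = 0) → (∀ q, t q x = 0) → ∀ ℓ, G.node ℓ ∈ J →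
      cornerMomentum x (opposite (G.tgt ℓ)) (G.color (G.tgt ℓ).1)
        = x (G.node ℓ) (G.color (G.tgt ℓ).1)) :
    5 * (J.card : ℤ) ≤
      Fintype.card Q + 2 * (G.linesOf J).card + G.divergenceDegree (G.linesOf J) := by
  let U : (G.Node → Fin 6 → ℚ) →ₗ[ℚ] (Q → ℚ) × ({C // C ∈ J} → ℚ) × ({C // C ∉ J} → Fin 6 → ℚ) :=
    (LinearMap.pi t).prod <|
      (LinearMap.pi fun C => (∑ c, LinearMap.proj c) ∘ₗ LinearMap.proj C.1).prod
      (LinearMap.pi fun C => LinearMap.proj C.1)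
  have hker (x : LinearMap.ker U) :
      LinearMap.funLeft ℚ (Fin 6 → ℚ) G.node x.1 ∈ G.closedFlows (G.linesOf J) := by
    obtain ⟨x, hx⟩ := x
    obtain ⟨hQ, hJx⟩ := Prod.ext_iff.1 (LinearMap.mem_ker.1 hx)
    obtain ⟨hgauge, hoff⟩ := Prod.ext_iff.1 hJx
    have hoff (C : G.Node) (hC : C ∉ J) : x C = 0 := congrFun hoff ⟨C, hC⟩
    refine comp_node_mem_closedFlows hJ hoff (fun C => ?_) (ht x hoff (congrFun hQ))
    by_cases hC : C ∈ J
    · simpa [U] using congrFun hgauge ⟨C, hC⟩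
    · simp [hoff C hC]
  have hinj : Function.Injective <|
      ((LinearMap.funLeft ℚ (Fin 6 → ℚ) G.node).domRestrict (LinearMap.ker U)).codRestrict _ hker :=
    fun x y h => Subtype.ext (G.node_surjective.injective_comp_right (congrArg Subtype.val h))
  have hle := LinearMap.finrank_le_finrank_of_injective hinj
  have hrank := LinearMap.finrank_range_add_finrank_ker U
  have hrange := Submodule.finrank_le (LinearMap.range U)
  have hcompl := Fintype.card_subtype_compl (· ∈ J)
  have hcard := J.card_le_univ
  have hflow := finrank_closedFlows_le (G := G) (G.linesOf J)
  simp only [Module.finrank_prod, Module.finrank_pi_fintype, Module.finrank_self,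
    Finset.sum_const, Finset.card_univ, Fintype.card_fin, smul_eq_mul, Fintype.card_coe]
    at hrank hrange hcompl
  omega

end Corners

section Convergence

variable {V L : Type*} {G : FeynmanGraph V L}

theorem isConnectedSubgraph_linesOf_singleton [Fintype L] (C : G.Node) :
    G.IsConnectedSubgraph (G.linesOf {C}) := by
  obtain ⟨ℓ₀, rfl⟩ := G.node_surjective C
  refine ⟨⟨ℓ₀, mem_linesOf.2 (Finset.mem_singleton_self _)⟩, fun ℓ hℓ ℓ' hℓ' => ?_⟩
  rw [mem_linesOf] at hℓ hℓ'
  exact reachable_of_node_eq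
    ((Finset.mem_singleton.1 hℓ).trans (Finset.mem_singleton.1 hℓ').symm) hℓ

theorem three_le_card_linesOf_of_forall_color_eq [Fintype L] (hG : G.IsCompletelyConvergent)
    {C : G.Node} (hC : G.IsClosedNode C) {c₀ : Fin 6}
    (hcolor : ∀ ℓ, G.node ℓ = C → G.color (G.tgt ℓ).1 = c₀) : 3 ≤ (G.linesOf {C}).card := by
  have hω := hG _ (isConnectedSubgraph_linesOf_singleton C)
  have hcount := five_mul_card_le (J := {C}) (Q := Unit) (by simpa using hC)
    (fun _ => LinearMap.proj c₀ ∘ₗ LinearMap.proj C) fun x hx hx₀ ℓ hℓ => ?_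
  · rw [Finset.card_singleton, Fintype.card_unit] at hcount
    omega
  · have hℓ : G.node ℓ = C := Finset.mem_singleton.1 hℓ
    have hzero : x C c₀ = 0 := hx₀ ()
    rw [hcolor ℓ hℓ, hℓ, hzero]
    by_cases hopp : ∃ ℓ', G.tgt ℓ' = opposite (G.tgt ℓ)
    · obtain ⟨ℓ', hℓ'⟩ := hopp
      rw [← hℓ', cornerMomentum_tgt]
      by_cases hnode : G.node ℓ' = C
      · rw [hnode, hzero]
      · rw [hx _ (mt Finset.mem_singleton.1 hnode), Pi.zero_apply]
    · rw [cornerMomentum_of_notMem_range x hopp, Pi.zero_apply]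

theorem two_le_card_linesOf [Fintype L] (hG : G.IsCompletelyConvergent) {C : G.Node}
    (hC : G.IsClosedNode C) : 2 ≤ (G.linesOf {C}).card := by
  obtain ⟨ℓ₀, rfl⟩ := G.node_surjective C
  by_contra! hlt
  have hunique (ℓ : L) (hℓ : G.node ℓ = G.node ℓ₀) : ℓ = ℓ₀ :=
    Finset.card_le_one.1 (Nat.le_of_lt_succ hlt) ℓ (mem_linesOf.2 (Finset.mem_singleton.2 hℓ)) ℓ₀
      (mem_linesOf.2 (Finset.mem_singleton_self _))
  have := three_le_card_linesOf_of_forall_color_eq hG hC (c₀ := G.color (G.tgt ℓ₀).1)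
    fun ℓ hℓ => by rw [hunique ℓ hℓ]
  omega

variable (G) in
/-- A closed node with exactly two lines. -/
structure IsTwoNode [Fintype L] (C : G.Node) : Prop where
  isClosedNode : G.IsClosedNode C
  card_linesOf : (G.linesOf {C}).card = 2

theorem IsTwoNode.eq_or_eq [Fintype L] {a b ℓ : L} (hC : G.IsTwoNode (G.node a))
    (hb : G.node b = G.node a) (hab : a ≠ b) (hℓ : G.node ℓ = G.node a) : ℓ = a ∨ ℓ = b := by
  by_contra! hne
  refine absurd hC.card_linesOf (Finset.two_lt_card.2 ⟨a, ?_, b, ?_, ℓ, ?_, hab, hne.1.symm,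
    hne.2.symm⟩).ne'
  all_goals rw [mem_linesOf, Finset.mem_singleton]
  exacts [hb, hℓ]

theorem IsTwoNode.exists_ne [Fintype L] {a : L} (hC : G.IsTwoNode (G.node a)) :
    ∃ b, a ≠ b ∧ G.node b = G.node a := by
  obtain ⟨b, hb, hne⟩ := Finset.exists_mem_ne (hC.card_linesOf ▸ one_lt_two) a
  exact ⟨b, hne.symm, Finset.mem_singleton.1 (mem_linesOf.1 hb)⟩

theorem IsTwoNode.color_ne [Fintype L] (hG : G.IsCompletelyConvergent) {a b : L}
    (hC : G.IsTwoNode (G.node a)) (hb : G.node b = G.node a) (hab : a ≠ b) :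
    G.color (G.tgt a).1 ≠ G.color (G.tgt b).1 := fun hcolor => by
  have := three_le_card_linesOf_of_forall_color_eq hG hC.isClosedNode
    (c₀ := G.color (G.tgt a).1) fun ℓ hℓ => by
      rcases hC.eq_or_eq hb hab hℓ with rfl | rfl
      exacts [rfl, hcolor.symm]
  have := hC.card_linesOf
  omega

variable (G) in
/-- The corners that follow two lines lie in the same bubble, opposite to each other, so that they
carry the same momentum in the special color of the bubble. -/
def Glued (ℓ ℓ' : L) : Prop := G.tgt ℓ' = opposite (G.tgt ℓ)

theorem Glued.symm {ℓ ℓ' : L} (h : G.Glued ℓ ℓ') : G.Glued ℓ' ℓ := by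
  rw [Glued, show G.tgt ℓ' = opposite (G.tgt ℓ) from h, opposite_opposite]

theorem Glued.irrefl (ℓ : L) : ¬ G.Glued ℓ ℓ := fun h => opposite_ne (G.tgt ℓ) (Eq.symm h)

theorem Glued.unique {ℓ ℓ₁ ℓ₂ : L} (h₁ : G.Glued ℓ ℓ₁) (h₂ : G.Glued ℓ ℓ₂) : ℓ₁ = ℓ₂ :=
  G.tgt_injective (Eq.trans h₁ (Eq.symm h₂))

variable (G) in
/-- Some lines of the two nodes are glued: the bubbles link nodes in this way into chains. -/
def Linked (C D : G.Node) : Prop := ∃ ℓ ℓ', G.node ℓ = C ∧ G.node ℓ' = D ∧ G.Glued ℓ ℓ'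

theorem isConnectedSubgraph_linesOf [Fintype L] {J : Finset G.Node} {C₀ : G.Node}
    (hJ : ∀ C, C ∈ J ↔ Relation.ReflTransGen G.Linked C₀ C) :
    G.IsConnectedSubgraph (G.linesOf J) := by
  obtain ⟨ℓ₀, rfl⟩ := G.node_surjective C₀
  have hreach (C : G.Node) (hC : Relation.ReflTransGen G.Linked (G.node ℓ₀) C) (ℓ : L)
      (hℓ : G.node ℓ = C) : (G.lineGraph (G.linesOf J)).Reachable (G.src ℓ₀).1 (G.src ℓ).1 := by
    induction hC generalizing ℓ with
    | refl => exact reachable_of_node_eq hℓ.symm ((hJ _).2 .refl)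
    | tail hD hlink ih =>
      obtain ⟨ℓ₁, ℓ₂, rfl, rfl, hglued⟩ := id hlink
      have hmem₁ : G.node ℓ₁ ∈ J := (hJ _).2 hD
      have hmem₂ : G.node ℓ₂ ∈ J := (hJ _).2 (hD.tail hlink)
      have htgt₁ := reachable_src_tgt (G := G) (H := G.linesOf J) (mem_linesOf.2 hmem₁)
      have htgt₂ := reachable_src_tgt (G := G) (H := G.linesOf J) (mem_linesOf.2 hmem₂)
      rw [show G.tgt ℓ₂ = opposite (G.tgt ℓ₁) from hglued] at htgt₂
      exact ((ih ℓ₁ rfl).trans htgt₁).trans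
        (htgt₂.symm.trans (reachable_of_node_eq hℓ.symm hmem₂))
  exact ⟨⟨ℓ₀, mem_linesOf.2 ((hJ _).2 .refl)⟩, fun ℓ hℓ ℓ' hℓ' =>
    (hreach _ ((hJ _).1 (mem_linesOf.1 hℓ)) ℓ rfl).symm.trans
      (hreach _ ((hJ _).1 (mem_linesOf.1 hℓ')) ℓ' rfl)⟩

theorem ten_mul_card_le_of_forall_exists_glued [Fintype L] {J : Finset G.Node}
    (hJ : ∀ C ∈ J, G.IsClosedNode C)
    (hglued : ∀ ℓ ∈ G.linesOf J, ∃ ℓ' ∈ G.linesOf J, G.Glued ℓ ℓ') :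
    10 * (J.card : ℤ) ≤ 5 * (G.linesOf J).card + 2 * G.divergenceDegree (G.linesOf J) := by
  classical
  choose! β hβ hglue using hglued
  have hββ (ℓ : L) (hℓ : ℓ ∈ G.linesOf J) : β (β ℓ) = ℓ :=
    (hglue _ (hβ ℓ hℓ)).unique (hglue ℓ hℓ).symm
  have hside (ℓ : L) (hℓ : ℓ ∈ G.linesOf J) : (G.tgt (β ℓ)).2 = !(G.tgt ℓ).2 :=
    congrArg Prod.snd (hglue ℓ hℓ)
  let Q : Finset L := {ℓ ∈ G.linesOf J | (G.tgt ℓ).2 = true}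
  have hQ : 2 * Q.card = (G.linesOf J).card := by
    rw [← Finset.card_filter_add_card_filter_not (s := G.linesOf J) fun ℓ => (G.tgt ℓ).2 = true,
      two_mul, Nat.add_left_cancel_iff]
    refine Finset.card_bij' (fun ℓ _ => β ℓ) (fun ℓ _ => β ℓ) ?_ ?_ ?_ ?_ <;> intro ℓ hℓ <;>
      obtain ⟨hℓ, hside'⟩ := Finset.mem_filter.1 hℓ
    · exact Finset.mem_filter.2 ⟨hβ ℓ hℓ, by simp [hside ℓ hℓ, hside']⟩
    · exact Finset.mem_filter.2 ⟨hβ ℓ hℓ, by simpa [hside ℓ hℓ] using hside'⟩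
    · exact hββ ℓ hℓ
    · exact hββ ℓ hℓ
  let momentum (C : G.Node) : (G.Node → Fin 6 → ℚ) →ₗ[ℚ] Fin 6 → ℚ := LinearMap.proj C
  have hcount := five_mul_card_le hJ (Q := Q) (fun ℓ => LinearMap.proj (G.color (G.tgt ℓ.1).1) ∘ₗ
    (momentum (G.node ℓ.1) - momentum (G.node (β ℓ.1)))) fun x _ hx ℓ hℓ => ?_
  · rw [Fintype.card_coe] at hcount
    omega
  · have hℓ := mem_linesOf.2 hℓ
    have heq (ℓ : L) (hℓ : ℓ ∈ Q) : x (G.node ℓ) (G.color (G.tgt ℓ).1)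
        = x (G.node (β ℓ)) (G.color (G.tgt ℓ).1) := sub_eq_zero.1 (hx ⟨ℓ, hℓ⟩)
    rw [← hglue ℓ hℓ, cornerMomentum_tgt]
    cases hs : (G.tgt ℓ).2 with
    | true => exact (heq ℓ (Finset.mem_filter.2 ⟨hℓ, hs⟩)).symm
    | false =>
      have hβQ : β ℓ ∈ Q := Finset.mem_filter.2 ⟨hβ ℓ hℓ, by rw [hside ℓ hℓ, hs, Bool.not_false]⟩
      have := heq _ hβQ
      rwa [hββ ℓ hℓ, hglue ℓ hℓ] at this

theorem exists_forall_not_glued [Fintype L] (hG : G.IsCompletelyConvergent) {J : Finset G.Node}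
    (hJ : J.Nonempty) (htwo : ∀ C ∈ J, G.IsTwoNode C) :
    ∃ ℓ ∈ G.linesOf J, ∀ ℓ' ∈ G.linesOf J, ¬ G.Glued ℓ ℓ' := by
  classical
  by_contra! hglued
  obtain ⟨C₀, hC₀⟩ := hJ
  let S : Finset G.Node := {C | Relation.ReflTransGen G.Linked C₀ C}
  have hS (C : G.Node) : C ∈ S ↔ Relation.ReflTransGen G.Linked C₀ C := by
    simp only [S, Finset.mem_filter, Finset.mem_univ, true_and]
  have hSJ (C : G.Node) (hC : C ∈ S) : C ∈ J := by
    rw [hS] at hC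
    induction hC with
    | refl => exact hC₀
    | tail _ hlink hD =>
      obtain ⟨ℓ, ℓ', rfl, rfl, hlink⟩ := hlink
      obtain ⟨ℓ'', hℓ'', hlink'⟩ := hglued ℓ (mem_linesOf.2 hD)
      rw [hlink.unique hlink']
      exact mem_linesOf.1 hℓ''
  have hSglued (ℓ : L) (hℓ : ℓ ∈ G.linesOf S) : ∃ ℓ' ∈ G.linesOf S, G.Glued ℓ ℓ' := by
    rw [mem_linesOf] at hℓ
    obtain ⟨ℓ', -, hlink⟩ := hglued ℓ (mem_linesOf.2 (hSJ _ hℓ))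
    exact ⟨ℓ', mem_linesOf.2 ((hS _).2 (((hS _).1 hℓ).tail ⟨ℓ, ℓ', rfl, rfl, hlink⟩)), hlink⟩
  have hcard : (G.linesOf S).card = 2 * S.card := by
    rw [card_linesOf, Finset.sum_congr rfl fun C hC => (htwo C (hSJ C hC)).card_linesOf,
      Finset.sum_const, smul_eq_mul, mul_comm]
  have hcount := ten_mul_card_le_of_forall_exists_glued
    (fun C hC => (htwo C (hSJ C hC)).isClosedNode) hSglued
  have hω := hG _ (isConnectedSubgraph_linesOf hS)
  omega

end Convergence

/-! ### Chains of two-line nodes -/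

section Orientation

variable {V L : Type*} {G : FeynmanGraph V L}

variable (G) in
/-- An orientation of the chains formed by the two-line nodes in `J`: the lines of `C` are `a C` and
`b C`, and the rank `r` decreases along the chain from `C` to the node glued to `C` at `a C`, and
increases towards the node glued to `C` at `b C`. -/
structure IsChainOrientation (J : Finset G.Node) (a b : G.Node → L) (r : G.Node → ℤ) : Prop where
  node_eq_iff : ∀ C ∈ J, ∀ ℓ, G.node ℓ = C ↔ ℓ = a C ∨ ℓ = b C
  ne : ∀ C ∈ J, a C ≠ b C
  rank_lt : ∀ C ∈ J, ∀ ℓ, G.node ℓ ∈ J → G.Glued (a C) ℓ → r (G.node ℓ) < r C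
  lt_rank : ∀ C ∈ J, ∀ ℓ, G.node ℓ ∈ J → G.Glued (b C) ℓ → r C < r (G.node ℓ)

namespace IsChainOrientation

variable {J : Finset G.Node} {a b : G.Node → L} {r : G.Node → ℤ}

theorem node_left (h : G.IsChainOrientation J a b r) {C : G.Node} (hC : C ∈ J) :
    G.node (a C) = C := (h.node_eq_iff C hC _).2 (Or.inl rfl)

theorem node_right (h : G.IsChainOrientation J a b r) {C : G.Node} (hC : C ∈ J) :
    G.node (b C) = C := (h.node_eq_iff C hC _).2 (Or.inr rfl)

theorem symm (h : G.IsChainOrientation J a b r) : G.IsChainOrientation J b a (-r) where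
  node_eq_iff C hC ℓ := (h.node_eq_iff C hC ℓ).trans or_comm
  ne C hC := (h.ne C hC).symm
  rank_lt C hC ℓ hℓ hglued := neg_lt_neg (h.lt_rank C hC ℓ hℓ hglued)
  lt_rank C hC ℓ hℓ hglued := neg_lt_neg (h.rank_lt C hC ℓ hℓ hglued)

theorem update [DecidableEq G.Node] (h : G.IsChainOrientation J a b r) {i : G.Node} {x y : L}
    {ρ : ℤ} (hi : i ∉ J) (hlines : ∀ ℓ, G.node ℓ = i ↔ ℓ = x ∨ ℓ = y) (hxy : x ≠ y)
    (hx : ∀ ℓ, G.node ℓ ∈ insert i J → ¬ G.Glued x ℓ) (hy : ∀ ℓ, G.Glued y ℓ → G.node ℓ ≠ i)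
    (hb : ∀ C ∈ J, ∀ ℓ, G.Glued (b C) ℓ → G.node ℓ ≠ i) (hρ : ∀ C ∈ J, ρ < r C) :
    G.IsChainOrientation (insert i J) (Function.update a i x) (Function.update b i y)
      (Function.update r i ρ) := by
  have hne (C : G.Node) (hC : C ∈ J) : C ≠ i := fun heq => hi (heq ▸ hC)
  constructor <;> refine (Finset.forall_mem_insert _ _ _).2 ⟨?_, fun C hC => ?_⟩
  · simpa only [Function.update_self] using hlines
  · simpa only [Function.update_of_ne (hne C hC)] using h.node_eq_iff C hC
  · simpa only [Function.update_self] using hxy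
  · simpa only [Function.update_of_ne (hne C hC)] using h.ne C hC
  · intro ℓ hℓ hglued
    rw [Function.update_self] at hglued
    exact absurd hglued (hx ℓ hℓ)
  · intro ℓ hℓ hglued
    rw [Function.update_of_ne (hne C hC)] at hglued ⊢
    by_cases hℓi : G.node ℓ = i
    · rw [hℓi, Function.update_self]
      exact hρ C hC
    · rw [Function.update_of_ne hℓi]
      exact h.rank_lt C hC ℓ (Finset.mem_of_mem_insert_of_ne hℓ hℓi) hglued
  · intro ℓ hℓ hglued
    rw [Function.update_self] at hglued ⊢
    rw [Function.update_of_ne (hy ℓ hglued)]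
    exact hρ _ (Finset.mem_of_mem_insert_of_ne hℓ (hy ℓ hglued))
  · intro ℓ hℓ hglued
    rw [Function.update_of_ne (hne C hC)] at hglued ⊢
    rw [Function.update_of_ne (hb C hC ℓ hglued)]
    exact h.lt_rank C hC ℓ (Finset.mem_of_mem_insert_of_ne hℓ (hb C hC ℓ hglued)) hglued

theorem exists_insert [Fintype L] [DecidableEq G.Node] (h : G.IsChainOrientation J a b r) {x y : L}
    (hC : G.IsTwoNode (G.node x)) (hxy : x ≠ y) (hnode : G.node y = G.node x)
    (hJ : G.node x ∉ J) (hx : ∀ ℓ, G.node ℓ ∈ insert (G.node x) J → ¬ G.Glued x ℓ)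
    (hy : ∀ C ∈ J, ¬ G.Glued y (b C)) :
    ∃ a b r, G.IsChainOrientation (insert (G.node x) J) a b r := by
  obtain ⟨ρ, hρ⟩ : ∃ ρ, ∀ C ∈ J, ρ < r C := by
    obtain ⟨M, hM⟩ := (J.image r).bddBelow
    exact ⟨M - 1, fun C hC => Int.sub_one_lt_of_le (hM (Finset.mem_image_of_mem r hC))⟩
  have hlines (ℓ : L) : G.node ℓ = G.node x ↔ ℓ = x ∨ ℓ = y :=
    ⟨hC.eq_or_eq hnode hxy, by rintro (rfl | rfl); exacts [rfl, hnode]⟩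
  refine ⟨_, _, _, h.update hJ hlines hxy hx (fun ℓ hglued hℓ => ?_)
    (fun C hCJ ℓ hglued hℓ => ?_) hρ⟩
  · rcases (hlines ℓ).1 hℓ with rfl | rfl
    · exact hx y (hnode ▸ Finset.mem_insert_self _ _) hglued.symm
    · exact Glued.irrefl _ hglued
  · rcases (hlines ℓ).1 hℓ with rfl | rfl
    · exact hx (b C) (Finset.mem_insert_of_mem ((h.node_right hCJ).symm ▸ hCJ)) hglued.symm
    · exact hy C hCJ hglued.symm

end IsChainOrientation

theorem exists_isChainOrientation [Fintype L] (hG : G.IsCompletelyConvergent) (J : Finset G.Node)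
    (hJ : ∀ C ∈ J, G.IsTwoNode C) : ∃ a b r, G.IsChainOrientation J a b r := by
  classical
  induction J using Finset.strongInduction with | H J ih
  obtain rfl | hne := J.eq_empty_or_nonempty
  · let a := Function.surjInv G.node_surjective
    exact ⟨a, a, 0, by constructor <;> simp⟩
  obtain ⟨x, hxJ, hfree⟩ := exists_forall_not_glued hG hne hJ
  simp only [mem_linesOf] at hxJ hfree
  obtain ⟨y, hxy, hnode⟩ := (hJ _ hxJ).exists_ne
  obtain ⟨a, b, r, h⟩ := ih _ (Finset.erase_ssubset hxJ) fun C hC =>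
    hJ C (Finset.mem_of_mem_erase hC)
  have hnotMem := Finset.notMem_erase (G.node x) J
  rw [← Finset.insert_erase hxJ] at hfree ⊢
  by_cases hy : ∀ C ∈ J.erase (G.node x), ¬ G.Glued y (b C)
  · exact h.exists_insert (hJ _ hxJ) hxy hnode hnotMem hfree hy
  · push Not at hy
    obtain ⟨C, hC, hglued⟩ := hy
    refine h.symm.exists_insert (hJ _ hxJ) hxy hnode hnotMem hfree fun D hD hglued' => ?_
    have heq : a D = b C := hglued'.unique hglued
    have hDC : D = C := by rw [← h.node_left hD, heq, h.node_right hC]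
    exact h.ne C hC (hDC ▸ heq)

end Orientation

/-! ### Summation over the momenta -/

section Momenta

variable {V L : Type*} (G : FeynmanGraph V L) (pext : {f // ¬ G.IsInternal f} → ℤ)

/-- The momenta of the six strands of a line. -/
noncomputable def lineMomentum (q : {f // G.IsInternal f} → ℤ) (ℓ : L) (c : Fin 6) : ℤ :=
  G.faceMomentum pext q (G.face ℓ c)

/-- The momenta of the internal faces that satisfy the gauge constraint `∑ p_c = 0` on each line. -/
def gaugeInvariant : Set ({f // G.IsInternal f} → ℤ) :=
  {q | ∀ ℓ, ∑ c, G.lineMomentum pext q ℓ c = 0}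

variable {G pext} {ℓ ℓ' : L} {c : Fin 6}

theorem lineMomentum_eq_of_faceStep (q : {f // G.IsInternal f} → ℤ)
    (h : G.FaceStep (ℓ, c) (ℓ', c)) : G.lineMomentum pext q ℓ c = G.lineMomentum pext q ℓ' c :=
  congrArg (G.faceMomentum pext q) (Quot.sound h)

theorem lineMomentum_eq_of_not_isInternal (q q' : {f // G.IsInternal f} → ℤ)
    (h : ¬ G.IsInternal (G.face ℓ c)) :
    G.lineMomentum pext q ℓ c = G.lineMomentum pext q' ℓ c := by
  simp only [lineMomentum, faceMomentum, dif_neg h]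

theorem mem_gaugeInvariant_of_integrand_ne_zero [Fintype L] {m : ℝ}
    {q : {f // G.IsInternal f} → ℤ} (h : G.integrand m pext q ≠ 0) : q ∈ G.gaugeInvariant pext :=
  fun ℓ => sum_eq_zero_of_propagator_ne_zero (Finset.prod_ne_zero_iff.1 h ℓ (Finset.mem_univ ℓ))

theorem lineMomentum_eq_of_lineStep (q : G.gaugeInvariant pext) (h : G.LineStep ℓ ℓ') :
    G.lineMomentum pext q ℓ = G.lineMomentum pext q ℓ' :=
  eq_of_sum_eq_zero (q.2 ℓ) (q.2 ℓ') (c₀ := G.color (G.tgt ℓ).1) fun _ hc =>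
    lineMomentum_eq_of_faceStep q ((faceStep_of_ne hc).2 h)

/-- The common momentum of the lines of a node. -/
noncomputable def nodeMomentum (q : G.gaugeInvariant pext) : G.Node → Fin 6 → ℤ :=
  Quot.lift (G.lineMomentum pext q) fun _ _ => lineMomentum_eq_of_lineStep q

theorem nodeMomentum_node (q : G.gaugeInvariant pext) (ℓ : L) :
    nodeMomentum q (G.node ℓ) = G.lineMomentum pext q ℓ := rfl

theorem sum_nodeMomentum (q : G.gaugeInvariant pext) (C : G.Node) :
    ∑ c, nodeMomentum q C c = 0 := by
  obtain ⟨ℓ, rfl⟩ := G.node_surjective C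
  exact q.2 ℓ

theorem nodeMomentum_injective :
    Function.Injective (nodeMomentum : G.gaugeInvariant pext → G.Node → Fin 6 → ℤ) := by
  refine fun q q' h => Subtype.ext (funext fun ⟨f, hf⟩ => ?_)
  obtain ⟨⟨ℓ, c⟩, rfl⟩ := Quot.exists_rep f
  have hf : G.IsInternal (G.face ℓ c) := hf
  have hface : G.faceMomentum pext q (G.face ℓ c) = G.faceMomentum pext q' (G.face ℓ c) :=
    congrFun (congrFun h (G.node ℓ)) c
  rwa [faceMomentum, dif_pos hf, faceMomentum, dif_pos hf] at hface

theorem nodeMomentum_eq_of_not_isClosedNode (q q' : G.gaugeInvariant pext) {C : G.Node}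
    (hC : ¬ G.IsClosedNode C) : nodeMomentum q C = nodeMomentum q' C := by
  simp only [IsClosedNode, not_forall, not_and_or] at hC
  obtain ⟨ℓ, rfl, hend⟩ := hC
  rcases hend with hend | hend
  · refine eq_of_sum_eq_zero (q.2 ℓ) (q'.2 ℓ) (c₀ := G.color (G.tgt ℓ).1) fun c hc =>
      lineMomentum_eq_of_not_isInternal q.1 q'.1 fun hint => hend ?_
    obtain ⟨⟨ℓ', c'⟩, hstep⟩ := (hint ℓ c rfl).1
    obtain rfl : c = c' := hstep.1
    exact ⟨ℓ', (faceStep_of_ne hc).1 hstep⟩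
  · refine eq_of_sum_eq_zero (q.2 ℓ) (q'.2 ℓ) (c₀ := G.color (G.src ℓ).1) fun c hc =>
      lineMomentum_eq_of_not_isInternal q.1 q'.1 fun hint => hend ?_
    obtain ⟨⟨ℓ', c'⟩, hstep⟩ := (hint ℓ c rfl).2
    obtain rfl : c' = c := hstep.1
    have hvertex : (G.tgt ℓ').1 = (G.src ℓ).1 := (congrArg Prod.fst hstep.2 :)
    exact ⟨ℓ', (faceStep_of_ne (hvertex ▸ hc)).1 hstep⟩

theorem nodeMomentum_color_eq {q q' : G.gaugeInvariant pext}
    (h : ∀ ℓ', G.IsClosedNode (G.node ℓ') → G.Glued ℓ ℓ' →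
      nodeMomentum q (G.node ℓ') = nodeMomentum q' (G.node ℓ')) :
    nodeMomentum q (G.node ℓ) (G.color (G.tgt ℓ).1)
      = nodeMomentum q' (G.node ℓ) (G.color (G.tgt ℓ).1) := by
  rw [nodeMomentum_node, nodeMomentum_node]
  by_cases hnext : ∃ ℓ', opposite (G.tgt ℓ) = G.src ℓ'
  · obtain ⟨ℓ', hℓ'⟩ := hnext
    rw [lineMomentum_eq_of_faceStep q.1 (faceStep_color.2 hℓ'),
      lineMomentum_eq_of_faceStep q'.1 (faceStep_color.2 hℓ'), ← nodeMomentum_node,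
      ← nodeMomentum_node]
    refine congrFun ?_ _
    by_cases hclosed : G.IsClosedNode (G.node ℓ')
    · obtain ⟨ℓ'', hstep⟩ := (hclosed ℓ' rfl).2
      rw [← hstep.node_eq] at hclosed ⊢
      exact h ℓ'' hclosed (Eq.trans hstep hℓ'.symm)
    · exact nodeMomentum_eq_of_not_isClosedNode q q' hclosed
  · refine lineMomentum_eq_of_not_isInternal q.1 q'.1 fun hint => hnext ?_
    obtain ⟨⟨ℓ', c⟩, hstep⟩ := (hint ℓ _ rfl).1
    obtain rfl : _ = c := hstep.1
    exact ⟨ℓ', faceStep_color.1 hstep⟩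

end Momenta

section Sum

variable {V L : Type*} {G : FeynmanGraph V L} {pext : {f // ¬ G.IsInternal f} → ℤ}

open Classical in
/-- The power of the propagator kept for each node: enough for the sum over the momentum of the node
to converge, and at most the number of its lines. -/
noncomputable def nodePower [Fintype L] (C : G.Node) : ℕ :=
  if G.IsTwoNode C then 2 else if G.IsClosedNode C then 3 else 0

open Classical in
/-- The ratio, for a two-line node, of the energies in the special colors of its two bubbles, which
follow the lines `a C` and `b C`. -/
noncomputable def energyRatio [Fintype L] (a b : G.Node → L) (m : ℝ) (C : G.Node)
    (p : Fin 6 → ℤ) : ℝ :=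
  if G.IsTwoNode C then
    √(energy m (p (G.color (G.tgt (a C)).1)) / energy m (p (G.color (G.tgt (b C)).1)))
  else 1

theorem energyRatio_pos [Fintype L] {m : ℝ} (hm : 0 < m) (a b : G.Node → L) (C : G.Node)
    (p : Fin 6 → ℤ) : 0 < energyRatio a b m C p := by
  rw [energyRatio]
  split_ifs
  · exact Real.sqrt_pos.2 (div_pos (energy_pos hm _) (energy_pos hm _))
  · exact one_pos

theorem inv_energyRatio [Fintype L] (a b : G.Node → L) (m : ℝ) (C : G.Node) (p : Fin 6 → ℤ) :
    (energyRatio a b m C p)⁻¹ = energyRatio b a m C p := by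
  rw [energyRatio, energyRatio]
  split_ifs
  · rw [← Real.sqrt_inv, inv_div]
  · exact inv_one

theorem nodePower_le_card_linesOf [Fintype L] (hG : G.IsCompletelyConvergent) (C : G.Node) :
    nodePower C ≤ (G.linesOf {C}).card := by
  rw [nodePower]
  split_ifs with htwo hclosed
  · exact htwo.card_linesOf.ge
  · exact (two_le_card_linesOf hG hclosed).lt_of_ne fun h => htwo ⟨hclosed, h.symm⟩
  · exact Nat.zero_le _

/-- The summand attached to a node of momentum `p`, tilted by the energy ratio so that the sums over
the momenta of the two-line nodes can be performed successively along their chains. -/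
noncomputable def nodeWeight [Fintype L] (a b : G.Node → L) (m : ℝ) (C : G.Node)
    (p : Fin 6 → ℤ) : ℝ :=
  propagator m p ^ nodePower C * energyRatio a b m C p

theorem nodeWeight_nonneg [Fintype L] {m : ℝ} (hm : 0 < m) (a b : G.Node → L) (C : G.Node)
    (p : Fin 6 → ℤ) : 0 ≤ nodeWeight a b m C p :=
  mul_nonneg (pow_nonneg (propagator_nonneg m p) _) (energyRatio_pos hm a b C p).le

theorem two_mul_prod_propagator_pow_le [Fintype L] {m : ℝ} (hm : 0 < m) (a b : G.Node → L)
    (p : G.Node → Fin 6 → ℤ) :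
    2 * ∏ C, propagator m (p C) ^ nodePower C
      ≤ ∏ C, nodeWeight a b m C (p C) + ∏ C, nodeWeight b a m C (p C) := by
  have hP : 0 ≤ ∏ C, propagator m (p C) ^ nodePower C :=
    Finset.prod_nonneg fun C _ => pow_nonneg (propagator_nonneg m _) _
  have hR : 0 < ∏ C, energyRatio a b m C (p C) :=
    Finset.prod_pos fun C _ => energyRatio_pos hm a b C _
  simp only [nodeWeight, Finset.prod_mul_distrib, ← inv_energyRatio a b, Finset.prod_inv_distrib]
  set P := ∏ C, propagator m (p C) ^ nodePower C
  set R := ∏ C, energyRatio a b m C (p C)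
  have hRinv : 2 ≤ R + R⁻¹ := by
    have : R * R⁻¹ = 1 := mul_inv_cancel₀ hR.ne'
    nlinarith [sq_nonneg (R - R⁻¹), inv_pos.2 hR]
  nlinarith

/-- A common bound for the sums over the momenta of a single node. -/
noncomputable def nodeBound (m : ℝ) : ℝ :=
  max 1 (max ((1 / m + 4) ^ 5 * m⁻¹) ((1 / m + 4) ^ 3 * (1 / m + 16)))

theorem one_le_nodeBound (m : ℝ) : 1 ≤ nodeBound m := le_max_left _ _

theorem tsum_nodeWeight_le_of_not_isTwoNode [Fintype L] {m : ℝ} (hm : 0 < m) {a b : G.Node → L}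
    {C : G.Node} (htwo : ¬ G.IsTwoNode C) {S : Set (G.gaugeInvariant pext)} :
    ∑' p : (fun q => nodeMomentum q C) '' S, ENNReal.ofReal (nodeWeight a b m C p)
      ≤ ENNReal.ofReal (nodeBound m) := by
  by_cases hclosed : G.IsClosedNode C
  · simp only [nodeWeight, nodePower, energyRatio, if_neg htwo, if_pos hclosed, mul_one]
    refine (ENNReal.tsum_mono_subtype (fun p => ENNReal.ofReal (propagator m p ^ 3)) ?_).trans
      ((tsum_propagator_cube_le hm).trans
        (ENNReal.ofReal_le_ofReal ((le_max_left _ _).trans (le_max_right _ _))))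
    rintro _ ⟨q, -, rfl⟩
    exact sum_nodeMomentum q C
  · simp only [nodeWeight, nodePower, energyRatio, if_neg htwo, if_neg hclosed, mul_one, pow_zero,
      ENNReal.ofReal_one]
    have hsub : ((fun q => nodeMomentum q C) '' S).Subsingleton := by
      rintro _ ⟨q, -, rfl⟩ _ ⟨q', -, rfl⟩
      exact nodeMomentum_eq_of_not_isClosedNode q q' hclosed
    rw [ENNReal.tsum_set_one]
    refine le_trans ?_ (ENNReal.one_le_ofReal.2 (one_le_nodeBound m))
    exact_mod_cast Set.encard_le_one_iff_subsingleton.2 hsub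

theorem tsum_nodeWeight_le_of_isTwoNode [Fintype L] {m : ℝ} (hm : 0 < m)
    (hG : G.IsCompletelyConvergent) {a b : G.Node → L} {C : G.Node} (htwo : G.IsTwoNode C)
    (ha : G.node (a C) = C) (hb : G.node (b C) = C) (hab : a C ≠ b C)
    {S : Set (G.gaugeInvariant pext)} {x : ℤ}
    (hS : ∀ q ∈ S, nodeMomentum q C (G.color (G.tgt (a C)).1) = x) :
    ∑' p : (fun q => nodeMomentum q C) '' S, ENNReal.ofReal (nodeWeight a b m C p)
      ≤ ENNReal.ofReal (nodeBound m) := by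
  have hcolor := IsTwoNode.color_ne hG (ha.symm ▸ htwo) (hb.trans ha.symm) hab
  simp only [nodeWeight, nodePower, energyRatio, if_pos htwo]
  refine (ENNReal.tsum_mono_subtype (fun p => ENNReal.ofReal (propagator m p ^ 2 *
    √(energy m (p (G.color (G.tgt (a C)).1)) / energy m (p (G.color (G.tgt (b C)).1))))) ?_).trans
    ((tsum_propagator_sq_mul_sqrt_energy_div_le hm hcolor x).trans
      (ENNReal.ofReal_le_ofReal ((le_max_right _ _).trans (le_max_right _ _))))
  rintro _ ⟨q, hq, rfl⟩
  exact ⟨sum_nodeMomentum q C, hS q hq⟩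

theorem tsum_prod_nodeWeight_le [Fintype L] {m : ℝ} (hm : 0 < m) (hG : G.IsCompletelyConvergent)
    {J : Finset G.Node} (hJ : ∀ C, C ∈ J ↔ G.IsTwoNode C) {a b : G.Node → L} {r : G.Node → ℤ}
    (h : G.IsChainOrientation J a b r) :
    ∑' q : G.gaugeInvariant pext, ∏ C, ENNReal.ofReal (nodeWeight a b m C (nodeMomentum q C))
      ≤ ENNReal.ofReal (nodeBound m) ^ Fintype.card G.Node := by
  classical
  let rank (C : G.Node) : WithBot ℤ := if C ∈ J then r C else ⊥
  rw [← Finset.card_univ, ← Finset.prod_const]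
  refine tsum_prod_le_prod_of_slice_le (W := fun C p => ENNReal.ofReal (nodeWeight a b m C p))
    (K := fun _ => ENNReal.ofReal (nodeBound m)) rank nodeMomentum_injective fun C q => ?_
  by_cases hC : C ∈ J
  · refine tsum_nodeWeight_le_of_isTwoNode (x := nodeMomentum q C (G.color (G.tgt (a C)).1)) hm hG
      ((hJ C).1 hC) (h.node_left hC) (h.node_right hC) (h.ne C hC) fun q' hq' => ?_
    have hcolor := nodeMomentum_color_eq (q := q') (q' := q) (ℓ := a C) fun ℓ _ hglued => hq' _ ?_
    · rwa [h.node_left hC] at hcolor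
    · by_cases hℓ : G.node ℓ ∈ J
      · simpa only [rank, if_pos hℓ, if_pos hC, WithBot.coe_lt_coe] using h.rank_lt C hC ℓ hℓ hglued
      · simpa only [rank, if_neg hℓ, if_pos hC] using WithBot.bot_lt_coe _
  · exact tsum_nodeWeight_le_of_not_isTwoNode hm (mt (hJ C).2 hC)

theorem tsum_prod_propagator_pow_le [Fintype L] {m : ℝ} (hm : 0 < m)
    (hG : G.IsCompletelyConvergent) :
    ∑' q : G.gaugeInvariant pext,
        ENNReal.ofReal (∏ C, propagator m (nodeMomentum q C) ^ nodePower C)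
      ≤ ENNReal.ofReal (nodeBound m) ^ Fintype.card G.Node := by
  classical
  let J : Finset G.Node := {C | G.IsTwoNode C}
  have hJ (C : G.Node) : C ∈ J ↔ G.IsTwoNode C := by
    simp only [J, Finset.mem_filter, Finset.mem_univ, true_and]
  obtain ⟨a, b, r, h⟩ := exists_isChainOrientation hG J fun C => (hJ C).1
  have hAMGM (q : G.gaugeInvariant pext) :
      2 * ENNReal.ofReal (∏ C, propagator m (nodeMomentum q C) ^ nodePower C)
        ≤ ∏ C, ENNReal.ofReal (nodeWeight a b m C (nodeMomentum q C))
          + ∏ C, ENNReal.ofReal (nodeWeight b a m C (nodeMomentum q C)) := by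
    have hnonneg (a b : G.Node → L) (C : G.Node) (_ : C ∈ Finset.univ) :
        0 ≤ nodeWeight a b m C (nodeMomentum q C) :=
      nodeWeight_nonneg hm a b C _
    rw [← ENNReal.ofReal_prod_of_nonneg (hnonneg a b),
      ← ENNReal.ofReal_prod_of_nonneg (hnonneg b a),
      ← ENNReal.ofReal_add (Finset.prod_nonneg (hnonneg a b)) (Finset.prod_nonneg (hnonneg b a)),
      ← ENNReal.ofReal_ofNat, ← ENNReal.ofReal_mul zero_le_two]
    exact ENNReal.ofReal_le_ofReal (two_mul_prod_propagator_pow_le hm a b _)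
  refine (ENNReal.mul_le_mul_iff_right two_ne_zero ENNReal.ofNat_ne_top).1 ?_
  rw [← ENNReal.tsum_mul_left, two_mul (ENNReal.ofReal (nodeBound m) ^ _)]
  refine (ENNReal.tsum_le_tsum hAMGM).trans ?_
  rw [ENNReal.tsum_add]
  exact add_le_add (tsum_prod_nodeWeight_le hm hG hJ h) (tsum_prod_nodeWeight_le hm hG hJ h.symm)

/-- A bound, at least `1`, for the propagator. -/
noncomputable def propagatorBound (m : ℝ) : ℝ := max 1 (m ^ 2)⁻¹

theorem one_le_propagatorBound (m : ℝ) : 1 ≤ propagatorBound m := le_max_left _ _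

theorem propagator_le_propagatorBound {m : ℝ} (hm : 0 < m) (p : Fin 6 → ℤ) :
    propagator m p ≤ propagatorBound m :=
  (propagator_le_inv (by positivity)
    (le_add_of_nonneg_left (Finset.sum_nonneg fun _ _ => sq_nonneg _))).trans (le_max_right _ _)

theorem propagator_pow_le_propagatorBound_pow_mul {m : ℝ} (hm : 0 < m) (p : Fin 6 → ℤ) {k n : ℕ}
    (hkn : k ≤ n) : propagator m p ^ n ≤ propagatorBound m ^ n * propagator m p ^ k := by
  have hnonneg := propagator_nonneg m p
  calc propagator m p ^ n = propagator m p ^ (n - k) * propagator m p ^ k := by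
        rw [← pow_add, Nat.sub_add_cancel hkn]
    _ ≤ propagatorBound m ^ (n - k) * propagator m p ^ k := by
        gcongr
        exact propagator_le_propagatorBound hm p
    _ ≤ propagatorBound m ^ n * propagator m p ^ k := by
        gcongr
        exacts [one_le_propagatorBound m, Nat.sub_le n k]

theorem integrand_eq_prod_propagator_pow [Fintype L] (m : ℝ) (q : G.gaugeInvariant pext) :
    G.integrand m pext q = ∏ C, propagator m (nodeMomentum q C) ^ (G.linesOf {C}).card := by
  classical
  rw [integrand, ← Finset.prod_fiberwise Finset.univ G.node]
  refine Finset.prod_congr rfl fun C _ => ?_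
  have hlines : (Finset.univ.filter fun ℓ => G.node ℓ = C) = G.linesOf {C} := by
    ext ℓ
    simp only [Finset.mem_filter, Finset.mem_univ, true_and, mem_linesOf, Finset.mem_singleton]
  rw [hlines, ← Finset.prod_const]
  refine Finset.prod_congr rfl fun ℓ hℓ => ?_
  rw [← Finset.mem_singleton.1 (mem_linesOf.1 hℓ)]
  rfl

theorem integrand_le [Fintype L] {m : ℝ} (hm : 0 < m) (hG : G.IsCompletelyConvergent)
    (q : G.gaugeInvariant pext) :
    G.integrand m pext q ≤ propagatorBound m ^ Fintype.card L
      * ∏ C, propagator m (nodeMomentum q C) ^ nodePower C := by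
  have hcard : ∑ C, (G.linesOf {C}).card ≤ Fintype.card L :=
    (card_linesOf Finset.univ).symm.trans_le (Finset.card_le_univ _)
  calc G.integrand m pext q
      ≤ ∏ C, propagatorBound m ^ (G.linesOf {C}).card
          * propagator m (nodeMomentum q C) ^ nodePower C := by
        rw [integrand_eq_prod_propagator_pow]
        exact Finset.prod_le_prod (fun _ _ => pow_nonneg (propagator_nonneg m _) _) fun C _ =>
          propagator_pow_le_propagatorBound_pow_mul hm _ (nodePower_le_card_linesOf hG C)
    _ ≤ _ := by
        rw [Finset.prod_mul_distrib, Finset.prod_pow_eq_pow_sum]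
        gcongr
        exacts [Finset.prod_nonneg fun C _ => pow_nonneg (propagator_nonneg m _) _,
          one_le_propagatorBound m]

theorem integrand_nonneg [Fintype L] (m : ℝ) (pext : {f // ¬ G.IsInternal f} → ℤ)
    (q : {f // G.IsInternal f} → ℤ) : 0 ≤ G.integrand m pext q :=
  Finset.prod_nonneg fun _ _ => propagator_nonneg m _

theorem card_lines_le [Fintype V] [Fintype L] (G : FeynmanGraph V L) :
    Fintype.card L ≤ 2 * Fintype.card V := by
  simpa [mul_comm] using Fintype.card_le_of_injective G.src G.src_injective

theorem tsum_integrand_le [Fintype L] {m : ℝ} (hm : 0 < m) (hG : G.IsCompletelyConvergent)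
    (pext : {f // ¬ G.IsInternal f} → ℤ) :
    ∑' q, ENNReal.ofReal (G.integrand m pext q)
      ≤ ENNReal.ofReal ((propagatorBound m * nodeBound m) ^ Fintype.card L) := by
  have hB := zero_le_one.trans (one_le_propagatorBound m)
  have hκ := one_le_nodeBound m
  have hsupp : (Function.support fun q => ENNReal.ofReal (G.integrand m pext q))
      ⊆ G.gaugeInvariant pext := fun q hq =>
    mem_gaugeInvariant_of_integrand_ne_zero (m := m) fun h =>
      hq (by simp only [h, ENNReal.ofReal_zero])
  calc ∑' q, ENNReal.ofReal (G.integrand m pext q)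
      = ∑' q : G.gaugeInvariant pext, ENNReal.ofReal (G.integrand m pext q) :=
        (tsum_subtype_eq_of_support_subset hsupp).symm
    _ ≤ ∑' q : G.gaugeInvariant pext, ENNReal.ofReal (propagatorBound m ^ Fintype.card L)
          * ENNReal.ofReal (∏ C, propagator m (nodeMomentum q C) ^ nodePower C) := by
        refine ENNReal.tsum_le_tsum fun q => ?_
        rw [← ENNReal.ofReal_mul (pow_nonneg hB _)]
        exact ENNReal.ofReal_le_ofReal (integrand_le hm hG q)
    _ ≤ ENNReal.ofReal (propagatorBound m ^ Fintype.card L)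
          * ENNReal.ofReal (nodeBound m) ^ Fintype.card L := by
        rw [ENNReal.tsum_mul_left]
        refine mul_le_mul_right ((tsum_prod_propagator_pow_le hm hG).trans ?_) _
        exact pow_le_pow_right₀ (ENNReal.one_le_ofReal.2 hκ)
          (Fintype.card_le_of_surjective _ G.node_surjective)
    _ = ENNReal.ofReal ((propagatorBound m * nodeBound m) ^ Fintype.card L) := by
        rw [← ENNReal.ofReal_pow (zero_le_one.trans hκ), ← ENNReal.ofReal_mul (pow_nonneg hB _),
          mul_pow]

theorem amplitude_le_of_tsum_integrand_le [Fintype L] {m K : ℝ} (hK : 0 ≤ K)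
    (h : ∑' q, ENNReal.ofReal (G.integrand m pext q) ≤ ENNReal.ofReal K) :
    Summable (G.integrand m pext) ∧ |G.amplitude m pext| ≤ K := by
  have hnonneg := integrand_nonneg (G := G) m pext
  have hsum : Summable (G.integrand m pext) := by
    simpa only [ENNReal.toReal_ofReal (hnonneg _)] using
      ENNReal.summable_toReal (h.trans_lt ENNReal.ofReal_lt_top).ne
  refine ⟨hsum, ?_⟩
  rwa [amplitude, abs_of_nonneg (tsum_nonneg hnonneg), ← ENNReal.ofReal_le_ofReal_iff hK,
    ENNReal.ofReal_tsum_of_nonneg hnonneg hsum]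

end Sum

end FeynmanGraph

open FeynmanGraph in
theorem mainTheorem6_general (m : ℝ) (hm : 0 < m) :
    ∃ K : ℝ, 0 < K ∧
      ∀ (V : Type*) (L : Type*) [Fintype V] [Fintype L] (G : FeynmanGraph V L),
        G.IsCompletelyConvergent →
          ∀ pext : {f : G.Face // ¬ G.IsInternal f} → ℤ,
            Summable (G.integrand m pext) ∧ |G.amplitude m pext| ≤ K ^ Fintype.card V := by
  have hK : 1 ≤ propagatorBound m * nodeBound m :=
    one_le_mul_of_one_le_of_one_le (one_le_propagatorBound m) (one_le_nodeBound m)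
  have hK' : 0 < propagatorBound m * nodeBound m := zero_lt_one.trans_le hK
  refine ⟨(propagatorBound m * nodeBound m) ^ 2, pow_pos hK' 2, fun V L _ _ G hG pext => ?_⟩
  refine amplitude_le_of_tsum_integrand_le (pow_nonneg (pow_nonneg hK'.le _) _)
    ((tsum_integrand_le hm hG pext).trans (ENNReal.ofReal_le_ofReal ?_))
  rw [← pow_mul]
  exact pow_le_pow_right₀ hK G.card_lines_le

theorem mainTheorem6 (m : ℝ) (hm : 0 < m) :
    ∃ K : ℝ, 0 < K ∧
      ∀ (V : Type*) (L : Type*) [Fintype V] [Fintype L] (G : FeynmanGraph V L),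
        G.IsConnected → G.IsCompletelyConvergent →
          ∀ pext : {f : G.Face // ¬ G.IsInternal f} → ℤ,
            Summable (G.integrand m pext) ∧
              |G.amplitude m pext| ≤ K ^ Fintype.card V := by
  obtain ⟨K, hK, h⟩ := mainTheorem6_general m hm
  exact ⟨K, hK, fun V L _ _ G _ => h V L G⟩
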